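/- All Hilbert spaces are finite-dimensional. Let $S$ be a system with density operator $\rho_S$, let $|\psi\rangle_{SE}$ be any purification of $\rho_S$, let $X=\{X_j\}$ be a projection-valued measure on $S$ (the projectors $X_j$ need not have rank one), and let $\{|j\rangle\}$ be orthonormal states of a register $M_X$. With the isometry $V_X=\sum_j|j\rangle_{M_X}\otimes X_j$, let $\tilde\rho_{M_XSE}=V_X|\psi\rangle\langle\psi|V_X^\dagger$ be the state after the premeasurement of $X$; its marginal $\tilde\rho_{M_XS}=V_X\rho_SV_X^\dagger$ is the premeasurement state. Let $D_K(P\|Q)\in[-\infty,\infty]$ be defined for all pairs of positive semidefinite operators on the same space and satisfy: (a) $D_K(\mathcal E(P)\|\mathcal E(Q))\le D_K(P\|Q)$ for every quantum channel $\mathcal E$ (completely positive trace-preserving map); (b) $D_K(P\oplus 0\|Q\oplus Q')=D_K(P\|Q)$. For a bipartite state put $$H_K(A|B)_\rho=\sup_{\sigma_B}\,[-D_K(\rho_{AB}\|\mathbb 1\otimes\sigma_B)]$$ over density operators $\sigma_B$, and $$\mathbb E_K^{A|B}=\inf_{\sigma\in\mathsf{Sep}}D_K(\rho_{AB}\|\sigma),\quad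 \Delta_K^{\overrightarrow{A|B}}=\inf_{\sigma\in\mathsf{CQ}}D_K(\rho_{AB}\|\sigma),\quad \Delta_K^{\overrightarrow{B|A}}=\inf_{\sigma\in\mathsf{QC}}D_K(\rho_{AB}\|\sigma),\quad \Delta_K^{\overleftrightarrow{A|B}}=\inf_{\sigma\in\mathsf{CC}}D_K(\rho_{AB}\|\sigma).$$ Here $\mathsf{Sep}$ is the set of separable states; $\mathsf{CQ}$ consists of the states $\sum_jp_j|j\rangle\langle j|\otimes\rho_{B,j}$, $\mathsf{QC}$ of the states $\sum_kp_k\,\rho_{A,k}\otimes|k\rangle\langle k|$, and $\mathsf{CC}$ of the states $\sum_{j,k}p_{j,k}|j\rangle\langle j|\otimes|k\rangle\langle k|$, for orthonormal bases $\{|j\rangle\}$ of $A$ and $\{|k\rangle\}$ of $B$, probability distributions $p$ and density operators $\rho_{B,j}$, $\rho_{A,k}$. The dual entropy $H_{\widehat K}(A|B)_\rho:=-H_K(A|C)$, where $\rho_{ABC}$ is a purification of $\rho_{AB}$, is well defined: it does not depend on the purification. With the uncertainty of $X$ given $E$ defined by $H_{\widehat K}(X|E):=H_{\widehat K}(M_X|E)_{\tilde\rho}$,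 one has $$H_{\widehat K}(X|E)=\mathbb E_K^{M_X|S}=\Delta_K^{\overrightarrow{M_X|S}}=\Delta_K^{\overrightarrow{S|M_X}}=\Delta_K^{\overleftrightarrow{M_X|S}},$$ where the measures on the right are evaluated on $\tilde\rho_{M_XS}$. In particular, let the logarithm have any fixed base greater than $1$, with $\log 0=-\infty$, let $$D_{\max}(P\|Q)=\log\min\{\lambda\ge 0:P\le\lambda Q\},\qquad D_{\mathrm{fid}}(P\|Q)=-2\log\operatorname{Tr}\big[(\sqrt P\,Q\sqrt P)^{1/2}\big]$$ (with $D_{\max}(P\|Q)=\infty$ if there is no such $\lambda$), and let $H_{\min}$ and $H_{\max}$ be the entropies $H_K$ for $D_K=D_{\max}$ and $D_K=D_{\mathrm{fid}}$, respectively. With $H_{\min}(X|E):=H_{\min}(M_X|E)_{\tilde\rho}$ and $H_{\max}(X|E):=H_{\max}(M_X|E)_{\tilde\rho}$, one has $$H_{\min}(X|E)=\mathbb E_{\mathrm{fid}}^{M_X|S}=\Delta_{\mathrm{fid}}^{\overrightarrow{M_X|S}}=\Delta_{\mathrm{fid}}^{\overrightarrow{S|M_X}}=\Delta_{\mathrm{fid}}^{\overleftrightarrow{M_X|S}},$$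 $$H_{\max}(X|E)=\mathbb E_{\max}^{M_X|S}=\Delta_{\max}^{\overrightarrow{M_X|S}}=\Delta_{\max}^{\overrightarrow{S|M_X}}=\Delta_{\max}^{\overleftrightarrow{M_X|S}}.$$ -/

import Mathlib

open scoped Kronecker MatrixOrder ComplexOrder ENNReal NNReal

universe u v

noncomputable section

namespace PremeasurementCollapse

/-! Finite-dimensional Hilbert spaces are `EuclideanSpace ℂ n` for finite index types `n`, operators
are complex matrices, and the composite of the systems `a` and `b` is indexed by `a × b`. -/

section States

variable {a b c n : Type*} [Fintype a] [Fintype b] [Fintype c] [Fintype n]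

/-- Normalized density operators. -/
def IsDensity (ρ : Matrix n n ℂ) : Prop :=
  ρ.PosSemidef ∧ ρ.trace = 1

/-- The rank-one operator `|v⟩⟨v|`. -/
def ketbra (v : EuclideanSpace ℂ n) : Matrix n n ℂ :=
  Matrix.of fun i j => v i * star (v j)

/-- The partial trace over the second of two systems. -/
def traceRight (M : Matrix (a × b) (a × b) ℂ) : Matrix a a ℂ :=
  Matrix.of fun i j => ∑ k, M (i, k) (j, k)

/-- The marginal on the first and the third of three systems. -/
def traceMiddle (M : Matrix ((a × b) × c) ((a × b) × c) ℂ) : Matrix (a × c) (a × c) ℂ :=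
  Matrix.of fun i j => ∑ k, M ((i.1, k), i.2) ((j.1, k), j.2)

/-- The vector `φ` on the composite of `a` and `c` purifies `ρ` on `a`. -/
def IsPurification (φ : EuclideanSpace ℂ (a × c)) (ρ : Matrix a a ℂ) : Prop :=
  traceRight (ketbra φ) = ρ

/-- The separable states: convex combinations of product states. -/
def Sep (a b : Type*) [Fintype a] [Fintype b] : Set (Matrix (a × b) (a × b) ℂ) :=
  {σ | ∃ (k : ℕ) (p : Fin k → ℝ) (α : Fin k → Matrix a a ℂ) (β : Fin k → Matrix b b ℂ),
    (∀ j, 0 ≤ p j) ∧ ∑ j, p j = 1 ∧ (∀ j, IsDensity (α j)) ∧ (∀ j, IsDensity (β j)) ∧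
    σ = ∑ j, (p j : ℂ) • (α j ⊗ₖ β j)}

/-- The classical-quantum states: classical on the first system. -/
def CQ (a b : Type*) [Fintype a] [Fintype b] : Set (Matrix (a × b) (a × b) ℂ) :=
  {σ | ∃ (f : OrthonormalBasis a ℂ (EuclideanSpace ℂ a)) (p : a → ℝ) (β : a → Matrix b b ℂ),
    (∀ j, 0 ≤ p j) ∧ ∑ j, p j = 1 ∧ (∀ j, IsDensity (β j)) ∧
    σ = ∑ j, (p j : ℂ) • (ketbra (f j) ⊗ₖ β j)}

/-- The quantum-classical states: classical on the second system. -/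
def QC (a b : Type*) [Fintype a] [Fintype b] : Set (Matrix (a × b) (a × b) ℂ) :=
  {σ | ∃ (g : OrthonormalBasis b ℂ (EuclideanSpace ℂ b)) (p : b → ℝ) (α : b → Matrix a a ℂ),
    (∀ k, 0 ≤ p k) ∧ ∑ k, p k = 1 ∧ (∀ k, IsDensity (α k)) ∧
    σ = ∑ k, (p k : ℂ) • (α k ⊗ₖ ketbra (g k))}

/-- The classical-classical states. -/
def CC (a b : Type*) [Fintype a] [Fintype b] : Set (Matrix (a × b) (a × b) ℂ) :=
  {σ | ∃ (f : OrthonormalBasis a ℂ (EuclideanSpace ℂ a))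
    (g : OrthonormalBasis b ℂ (EuclideanSpace ℂ b)) (p : a → b → ℝ),
    (∀ j k, 0 ≤ p j k) ∧ ∑ j, ∑ k, p j k = 1 ∧
    σ = ∑ j, ∑ k, (p j k : ℂ) • (ketbra (f j) ⊗ₖ ketbra (g k))}

end States

section RelativeEntropies

/-- An assignment of an extended real number to two operators on the same system, on all systems.
Only its values on positive semidefinite operators matter below. -/
abbrev RelEnt : Type (u + 1) :=
  ∀ (n : Type u) [Fintype n] [DecidableEq n], Matrix n n ℂ → Matrix n n ℂ → EReal

/-- Quantum channels, that is, completely positive trace-preserving maps, in Kraus form. -/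
def IsChannel {n m : Type*} [Fintype n] [DecidableEq n] [Fintype m]
    (Φ : Matrix n n ℂ → Matrix m m ℂ) : Prop :=
  ∃ (r : ℕ) (K : Fin r → Matrix m n ℂ), ∑ i, (K i).conjTranspose * K i = 1 ∧
    ∀ P, Φ P = ∑ i, K i * P * (K i).conjTranspose

/-- `D` is non-increasing under quantum channels. -/
def ChannelMonotone (D : RelEnt.{u}) : Prop :=
  ∀ (n m : Type u) [Fintype n] [DecidableEq n] [Fintype m] [DecidableEq m]
    (Φ : Matrix n n ℂ → Matrix m m ℂ), IsChannel Φ →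
    ∀ P Q : Matrix n n ℂ, P.PosSemidef → Q.PosSemidef → D m (Φ P) (Φ Q) ≤ D n P Q

/-- `D` is unaffected by null subspaces: `D(P ⊕ 0 ‖ Q ⊕ R) = D(P ‖ Q)`. -/
def NullSubspaceInvariant (D : RelEnt.{u}) : Prop :=
  ∀ (n m : Type u) [Fintype n] [DecidableEq n] [Fintype m] [DecidableEq m]
    (P Q : Matrix n n ℂ) (R : Matrix m m ℂ), P.PosSemidef → Q.PosSemidef → R.PosSemidef →
    D (n ⊕ m) (Matrix.fromBlocks P 0 0 0) (Matrix.fromBlocks Q 0 0 R) = D n P Q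

/-- The logarithm to the base `β`, with `log 0 = -∞` and `log ∞ = ∞`. -/
def logBase (β : ℝ) (x : ℝ≥0∞) : EReal :=
  ENNReal.log x / (Real.log β : EReal)

/-- `D_max(P ‖ Q) = log min {λ : P ≤ λ Q}`, which is `∞` if there is no such `λ`. -/
def Dmax (β : ℝ) : RelEnt.{u} := fun _ _ _ P Q =>
  logBase β (⨅ (l : ℝ≥0) (_ : (((l : ℝ) : ℂ) • Q - P).PosSemidef), (l : ℝ≥0∞))

/-- `D_fid(P ‖ Q) = -2 log Tr (√P Q √P)^{1/2}`, which is `∞` if the trace vanishes. -/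
def Dfid (β : ℝ) : RelEnt.{u} := fun _ _ _ P Q =>
  (-2 : EReal) * logBase β
    (ENNReal.ofReal (CFC.sqrt (CFC.sqrt P * Q * CFC.sqrt P)).trace.re)

variable {a b : Type u} [Fintype a] [DecidableEq a] [Fintype b] [DecidableEq b]

/-- The entanglement measure based on `D`. -/
def entanglement (D : RelEnt.{u}) (ρ : Matrix (a × b) (a × b) ℂ) : EReal :=
  ⨅ σ ∈ Sep a b, D (a × b) ρ σ

/-- The one-way discord based on `D`, for the first system. -/
def discordLeft (D : RelEnt.{u}) (ρ : Matrix (a × b) (a × b) ℂ) : EReal :=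
  ⨅ σ ∈ CQ a b, D (a × b) ρ σ

/-- The one-way discord based on `D`, for the second system. -/
def discordRight (D : RelEnt.{u}) (ρ : Matrix (a × b) (a × b) ℂ) : EReal :=
  ⨅ σ ∈ QC a b, D (a × b) ρ σ

/-- The two-way discord based on `D`. -/
def discordTwoWay (D : RelEnt.{u}) (ρ : Matrix (a × b) (a × b) ℂ) : EReal :=
  ⨅ σ ∈ CC a b, D (a × b) ρ σ

end RelativeEntropies

section ConditionalEntropies

/-- A conditional entropy of the first system given the second one. -/
abbrev CondEnt : Type (u + 1) :=
  ∀ (a b : Type u) [Fintype a] [DecidableEq a] [Fintype b] [DecidableEq b],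
    Matrix (a × b) (a × b) ℂ → EReal

/-- `H_K(A|B) = sup_σ [-D_K(ρ_AB ‖ 1 ⊗ σ_B)]` over the density operators `σ` on `B`. -/
def condEntropy (D : RelEnt.{u}) : CondEnt.{u} := fun a b _ _ _ _ ρ =>
  ⨆ (σ : Matrix b b ℂ) (_ : IsDensity σ), -D (a × b) ρ ((1 : Matrix a a ℂ) ⊗ₖ σ)

/-- The min-entropy. -/
def Hmin (β : ℝ) : CondEnt.{u} := condEntropy (Dmax β)

/-- The max-entropy. -/
def Hmax (β : ℝ) : CondEnt.{u} := condEntropy (Dfid β)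

/-- The purification `∑ᵢⱼ (√ρ)ᵢⱼ |i⟩|j⟩` of `ρ`, whose purifying system is a copy of the system. -/
def canonicalPurification {n : Type*} [Fintype n] [DecidableEq n] (ρ : Matrix n n ℂ) :
    EuclideanSpace ℂ (n × n) :=
  WithLp.toLp 2 fun x => (CFC.sqrt ρ) x.1 x.2

theorem isPurification_canonicalPurification {n : Type*} [Fintype n] [DecidableEq n]
    {ρ : Matrix n n ℂ} (h : ρ.PosSemidef) : IsPurification (canonicalPurification ρ) ρ := by
  have hs : (CFC.sqrt ρ).conjTranspose = CFC.sqrt ρ :=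
    (Matrix.nonneg_iff_posSemidef.mp (CFC.sqrt_nonneg ρ)).isHermitian
  have h2 : CFC.sqrt ρ * CFC.sqrt ρ = ρ :=
    CFC.sqrt_mul_sqrt_self ρ (Matrix.nonneg_iff_posSemidef.mpr h)
  have h3 : CFC.sqrt ρ * (CFC.sqrt ρ).conjTranspose = ρ := by rw [hs, h2]
  ext i j
  have h4 := congrFun (congrFun h3 i) j
  simpa [traceRight, ketbra, canonicalPurification, Matrix.mul_apply] using h4

/-- The entropy dual to `H_K`: `H_K̂(A|B) = -H_K(A|C)` for a purification of `ρ_AB` on `ABC`.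
It is computed here on the canonical purification. -/
def dualEntropy (D : RelEnt.{u}) : CondEnt.{u} := fun a b _ _ _ _ ρ =>
  -condEntropy D a (a × b) (traceMiddle (ketbra (canonicalPurification ρ)))

end ConditionalEntropies

section Premeasurement

variable {ι : Type v} [Fintype ι] {m s e : Type u} [Fintype m] [DecidableEq m]
  [Fintype s] [DecidableEq s] [Fintype e] [DecidableEq e]

/-- A projection valued measure; the projectors may have any rank, including zero. -/
structure IsPVM (X : ι → Matrix s s ℂ) : Prop where
  isStarProjection : ∀ j, IsStarProjection (X j)
  orthogonal : ∀ j k, j ≠ k → X j * X k = 0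
  sum_eq_one : ∑ j, X j = 1

/-- The premeasurement isometry `V_X = ∑ⱼ |j⟩ ⊗ X_j` from `S` to `M_X S`. -/
def premeasIsometry (w : ι → EuclideanSpace ℂ m) (X : ι → Matrix s s ℂ) :
    Matrix (m × s) s ℂ :=
  Matrix.of fun x t => ∑ j, w j x.1 * X j x.2 t

/-- The premeasurement state `V_X ρ_S V_X†` on `M_X S`. -/
def premeasState (w : ι → EuclideanSpace ℂ m) (X : ι → Matrix s s ℂ) (ρ : Matrix s s ℂ) :
    Matrix (m × s) (m × s) ℂ :=
  premeasIsometry w X * ρ * (premeasIsometry w X).conjTranspose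

/-- The pure state on `M_X S E` after the premeasurement of the pure state `ψ` on `S E`. -/
def premeasVector (w : ι → EuclideanSpace ℂ m) (X : ι → Matrix s s ℂ)
    (ψ : EuclideanSpace ℂ (s × e)) : EuclideanSpace ℂ ((m × s) × e) :=
  WithLp.toLp 2 ((premeasIsometry w X ⊗ₖ (1 : Matrix e e ℂ)).mulVec ψ.ofLp)

/-- The uncertainty `H(X|E) = H(M_X|E)` of the observable `X`, measured by the entropy `H`. -/
def uncertainty (H : CondEnt.{u}) (w : ι → EuclideanSpace ℂ m) (X : ι → Matrix s s ℂ)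
    (ψ : EuclideanSpace ℂ (s × e)) : EReal :=
  H m e (traceMiddle (ketbra (premeasVector w X ψ)))

end Premeasurement

end PremeasurementCollapse

end

open PremeasurementCollapse

/-!
The whole theorem rests on the identity `-H(M_X|S) = inf_σ D(ρ̃ ‖ 1 ⊗ σ)` for the premeasurement state
`ρ̃ = V ρ V†`, and on two bounds for this infimum: it is at most the smallest of the four measures of
correlation, the entanglement, and at least the largest of them, the two-way discord.

* A separable state `ω` lies below `1 ⊗ σ` with `σ` its second marginal, and a relative entropy that
  is monotone under channels and ignores null subspaces is antitone in its second argument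
  (`ChannelMonotone.anti_right`). So the infimum over `1 ⊗ σ` is at most the entanglement.
* Conversely, compressing `1 ⊗ σ` with the isometry `V` and applying `V` again yields
  `∑ⱼ |j⟩⟨j| ⊗ X_j σ X_j`, which is classical on both systems (`premeasState_pinch_mem_CC`), and this
  operation does not increase the relative entropy to `ρ̃`, because the complement of the range of `V`
  is a null subspace (`ChannelMonotone.compress_le`). So the two-way discord is at most the infimum.

This is `collapse`. The left-hand side is turned into the uncertainty of `X` given `E` by the
independence of the dual entropy from the purification (`dualEntropy_eq`): two purifications differ by
a contraction of the purifying systems, which extends to a channel. That contraction, like the polar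
decompositions used below, comes from a form of Douglas' factorization lemma
(`exists_isContraction_of_mul_conjTranspose_eq`).

For the min- and max-entropies it remains to verify the two properties for `D_max` and `D_fid`, and to
show that they are dual to each other (`condEntropy_Dmax_eq_neg_condEntropy_Dfid`). The fidelity is handled
through Uhlmann's description of it as a maximal overlap of purifications
(`re_trace_mul_conjTranspose_le_fidelity`, `exists_isContraction_trace_mul_eq_fidelity`). For the
duality on a pure state `φ` of `ABC`, let `λ` be the least number with `ρ_AB ≤ λ (1 ⊗ τ)` for a state
`τ`; the claim is that `λ` is the supremum of `F(ρ_AC, 1 ⊗ σ)²` over the states `σ`. That `λ` is an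
upper bound is a Cauchy-Schwarz inequality (`sq_fidelity_le`). If `v < λ`, a separating hyperplane
gives `Z ≥ 0` with `Tr_A Z ≤ 1` and `Tr Z ρ_AB > v` (`exists_dual_feasible`), and the normalized vector
`Z φ` is an admissible partner of `φ` in Uhlmann's theorem for a suitable `σ`, with squared overlap
`Tr Z ρ_AB` (`exists_isDensity_le_sq_fidelity`).
-/

set_option linter.unusedSectionVars false

namespace PremeasurementCollapse

open Matrix
open scoped Pointwise

/-! ### Contractions -/

section Contractions

variable {k l m n : Type*} [Fintype k] [DecidableEq k] [Fintype l] [DecidableEq l]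
  [Fintype m] [DecidableEq m] [Fintype n] [DecidableEq n]

/-- Matrices of operator norm at most one, expressed through the Loewner order. -/
def IsContraction (V : Matrix m n ℂ) : Prop :=
  (1 - Vᴴ * V).PosSemidef

theorem isContraction_iff_posSemidef_one_sub_mul_conjTranspose {V : Matrix m n ℂ} :
    IsContraction V ↔ (1 - V * Vᴴ).PosSemidef := by
  have : Invertible (1 : Matrix m m ℂ) := invertibleOne
  have : Invertible (1 : Matrix n n ℂ) := invertibleOne
  have h1 := PosDef.fromBlocks₁₁ V (1 : Matrix n n ℂ) (A := (1 : Matrix m m ℂ)) PosDef.one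
  have h2 := PosDef.fromBlocks₂₂ (1 : Matrix m m ℂ) V (D := (1 : Matrix n n ℂ)) PosDef.one
  simp only [inv_one, Matrix.mul_one] at h1 h2
  exact h1.symm.trans h2

theorem IsContraction.conjTranspose {V : Matrix m n ℂ} (h : IsContraction V) :
    IsContraction Vᴴ := by
  rw [isContraction_iff_posSemidef_one_sub_mul_conjTranspose, conjTranspose_conjTranspose]
  exact h

theorem IsContraction.mul {V : Matrix m n ℂ} {W : Matrix n k ℂ} (hV : IsContraction V)
    (hW : IsContraction W) : IsContraction (V * W) := by
  have h := PosSemidef.add hW (PosSemidef.conjTranspose_mul_mul_same hV W)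
  have e : 1 - Wᴴ * W + Wᴴ * (1 - Vᴴ * V) * W = 1 - (V * W)ᴴ * (V * W) := by
    rw [conjTranspose_mul, Matrix.mul_sub, Matrix.sub_mul, Matrix.mul_one]
    simp only [Matrix.mul_assoc, sub_add_sub_cancel]
  unfold IsContraction
  rwa [← e]

theorem conjTranspose_sqrt (P : Matrix n n ℂ) : (CFC.sqrt P)ᴴ = CFC.sqrt P :=
  (Matrix.nonneg_iff_posSemidef.mp (CFC.sqrt_nonneg P)).isHermitian

theorem _root_.Matrix.PosSemidef.sqrt_mul_sqrt {P : Matrix n n ℂ} (h : P.PosSemidef) :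
    CFC.sqrt P * CFC.sqrt P = P :=
  CFC.sqrt_mul_sqrt_self P (Matrix.nonneg_iff_posSemidef.mpr h)

theorem posSemidef_sqrt (P : Matrix n n ℂ) : (CFC.sqrt P).PosSemidef :=
  Matrix.nonneg_iff_posSemidef.mp (CFC.sqrt_nonneg P)

/-- A positive semidefinite `P` has a pseudo-inverse square root `R`: the matrix `R P R` is the
projection onto the range of `P`. -/
theorem exists_pseudoInverse_sqrt {P : Matrix n n ℂ} (hP : P.PosSemidef) :
    ∃ R : Matrix n n ℂ, Rᴴ = R ∧ R * P = P * R ∧ R * P * R * P = P ∧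
      (1 - R * P * R).PosSemidef ∧ (R * P * R)ᴴ = R * P * R := by
  have hsa : IsSelfAdjoint P := hP.isHermitian
  have hc : ∀ f : ℝ → ℝ, ContinuousOn f (spectrum ℝ P) := fun f =>
    (Matrix.finite_real_spectrum (A := P)).continuousOn f
  have hsp : ∀ x ∈ spectrum ℝ P, 0 ≤ x := fun x hx =>
    spectrum_nonneg_of_nonneg (Matrix.nonneg_iff_posSemidef.mpr hP) hx
  set f : ℝ → ℝ := fun x => (√x)⁻¹ with hf
  set R := cfc f P with hR
  have hRP : R * P = cfc (fun x => f x * x) P := by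
    rw [cfc_mul f (fun x => x) P (hc _) (hc _), cfc_id' ℝ P]
  have hPR : R * P = P * R := by
    rw [hRP]
    have : P * R = cfc (fun x => x * f x) P := by
      rw [cfc_mul (fun x => x) f P (hc _) (hc _), cfc_id' ℝ P]
    rw [this]
    simp only [mul_comm]
  have hRPR : R * P * R = cfc (fun x => f x * x * f x) P := by
    rw [hRP, cfc_mul (fun x => f x * x) f P (hc _) (hc _)]
  have hval : ∀ x : ℝ, 0 ≤ x → f x * x * f x = if x = 0 then 0 else 1 := by
    intro x hx
    split_ifs with h0
    · simp [h0]
    · have : √x ≠ 0 := fun h => h0 ((Real.sqrt_eq_zero hx).mp h)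
      simp only [hf]
      field_simp
      rw [Real.sq_sqrt hx]
  refine ⟨R, ?_, hPR, ?_, ?_, ?_⟩
  · exact cfc_predicate (R := ℝ) f P
  · calc R * P * R * P = cfc (fun x => f x * x * f x * x) P := by
          rw [hRPR, cfc_mul (fun x => f x * x * f x) (fun x => x) P (hc _) (hc _), cfc_id' ℝ P]
      _ = cfc (fun x => x) P := by
          refine cfc_congr fun x hx => ?_
          simp only [hval x (hsp x hx)]
          split_ifs with h0 <;> simp [h0]
      _ = P := cfc_id' ℝ P
  · rw [hRPR, ← Matrix.le_iff]
    refine cfc_le_one _ _ fun x hx => ?_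
    rw [hval x (hsp x hx)]
    split_ifs <;> simp
  · rw [hRPR]
    exact cfc_predicate (R := ℝ) _ P

/-- Douglas' factorization lemma, for two matrices with the same left absolute value. It is the
common source of the polar decomposition and of the equivalence of purifications. -/
theorem exists_isContraction_of_mul_conjTranspose_eq {M : Matrix n k ℂ} {N : Matrix n l ℂ}
    (h : M * Mᴴ = N * Nᴴ) : ∃ V : Matrix k l ℂ, IsContraction V ∧ N = M * V := by
  obtain ⟨R, hR, hc, hE, hle, hEs⟩ :=
    exists_pseudoInverse_sqrt (posSemidef_self_mul_conjTranspose M)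
  set P := M * Mᴴ with hP
  have hRN : IsContraction (R * N) := by
    rw [isContraction_iff_posSemidef_one_sub_mul_conjTranspose]
    have : R * N * (R * N)ᴴ = R * P * R := by
      rw [conjTranspose_mul, hR, h]
      simp only [Matrix.mul_assoc]
    rwa [this]
  refine ⟨Mᴴ * (R * (R * N)), ?_, ?_⟩
  · have h2 : IsContraction (Mᴴ * R) := by
      have : (Mᴴ * R)ᴴ * (Mᴴ * R) = R * P * R := by
        rw [conjTranspose_mul, hR, conjTranspose_conjTranspose, hP]
        simp only [Matrix.mul_assoc]
      unfold IsContraction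
      rwa [this]
    rw [← Matrix.mul_assoc]
    exact h2.mul hRN
  · have h3 : ((1 - R * P * R) * N) * ((1 - R * P * R) * N)ᴴ = 0 := by
      have h4 : (1 - R * P * R) * N * ((1 - R * P * R) * N)ᴴ
          = (P - R * P * R * P) * (1 - R * P * R) := by
        have h5 : P - R * P * R * P = (1 - R * P * R) * (N * Nᴴ) := by
          rw [← h, Matrix.sub_mul, Matrix.one_mul]
        rw [conjTranspose_mul, conjTranspose_sub, conjTranspose_one, hEs, h5]
        simp only [Matrix.mul_assoc]
      rw [h4, hE, sub_self, Matrix.zero_mul]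
    rw [self_mul_conjTranspose_eq_zero, Matrix.sub_mul, Matrix.one_mul, sub_eq_zero] at h3
    calc N = R * P * R * N := h3
      _ = P * R * R * N := by rw [hc]
      _ = M * (Mᴴ * (R * (R * N))) := by simp only [hP, Matrix.mul_assoc]

/-- The trace is the trace norm on positive semidefinite matrices. -/
theorem re_trace_mul_le_re_trace {L H : Matrix n n ℂ} (hL : IsContraction L)
    (hH : H.PosSemidef) : (L * H).trace.re ≤ H.trace.re := by
  set S := CFC.sqrt H
  have hS : Sᴴ = S := conjTranspose_sqrt H
  have hSS : S * S = H := hH.sqrt_mul_sqrt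
  have h1 := (posSemidef_self_mul_conjTranspose (S * L - S)).trace_nonneg
  have h2 := (PosSemidef.mul_mul_conjTranspose_same
    (isContraction_iff_posSemidef_one_sub_mul_conjTranspose.mp hL) S).trace_nonneg
  have e1 : ((S * L - S) * (S * L - S)ᴴ).trace =
      (S * L * Lᴴ * S).trace - (L * H).trace - (Lᴴ * H).trace + H.trace := by
    have : (S * L - S) * (S * L - S)ᴴ = S * L * Lᴴ * S - S * L * S - S * Lᴴ * S + S * S := by
      rw [conjTranspose_sub, conjTranspose_mul, hS]
      noncomm_ring
    have hcyc : ∀ Z : Matrix n n ℂ, (S * Z * S).trace = (Z * H).trace := fun Z => by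
      rw [trace_mul_comm, ← Matrix.mul_assoc, hSS, trace_mul_comm]
    rw [this, trace_add, trace_sub, trace_sub, hSS, hcyc L, hcyc Lᴴ]
  have e2 : (S * (1 - L * Lᴴ) * Sᴴ).trace = H.trace - (S * L * Lᴴ * S).trace := by
    rw [← trace_sub, ← hSS, hS]
    congr 1
    noncomm_ring
  have e3 : (Lᴴ * H).trace = star (L * H).trace := by
    rw [← trace_conjTranspose, conjTranspose_mul, hH.isHermitian.eq, trace_mul_comm]
  rw [e1, e3] at h1
  rw [e2] at h2
  have h1' := (Complex.le_def.mp h1).1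
  have h2' := (Complex.le_def.mp h2).1
  simp at h1' h2'
  linarith

end Contractions

/-! ### Fidelity -/

section Fidelity

variable {k m n : Type*} [Fintype k] [DecidableEq k] [Fintype m] [DecidableEq m]
  [Fintype n] [DecidableEq n]

/-- The fidelity `Tr (√P Q √P)^{1/2}`. -/
noncomputable def fidelity (P Q : Matrix n n ℂ) : ℝ :=
  (CFC.sqrt (CFC.sqrt P * Q * CFC.sqrt P)).trace.re

theorem fidelity_nonneg (P Q : Matrix n n ℂ) : 0 ≤ fidelity P Q :=
  (Complex.le_def.mp (posSemidef_sqrt _).trace_nonneg).1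

theorem sqrt_mul_sqrt_conj {P Q : Matrix n n ℂ} (hQ : Q.PosSemidef) :
    CFC.sqrt (CFC.sqrt P * Q * CFC.sqrt P) * CFC.sqrt (CFC.sqrt P * Q * CFC.sqrt P) =
      CFC.sqrt P * CFC.sqrt Q * (CFC.sqrt P * CFC.sqrt Q)ᴴ := by
  have h : (CFC.sqrt P * Q * CFC.sqrt P).PosSemidef := by
    have := hQ.mul_mul_conjTranspose_same (CFC.sqrt P)
    rwa [conjTranspose_sqrt] at this
  rw [h.sqrt_mul_sqrt, conjTranspose_mul, conjTranspose_sqrt, conjTranspose_sqrt]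
  conv_lhs => rw [← hQ.sqrt_mul_sqrt]
  simp only [Matrix.mul_assoc]

/-- The fidelity is an upper bound of `Re Tr X` over the off-diagonal blocks `X` of positive
semidefinite extensions of `P` and `Q`. -/
theorem re_trace_le_fidelity {P Q X : Matrix n n ℂ} (h : (fromBlocks P X Xᴴ Q).PosSemidef) :
    X.trace.re ≤ fidelity P Q := by
  have hP : P.PosSemidef := h.submatrix Sum.inl
  have hQ : Q.PosSemidef := h.submatrix Sum.inr
  set S := CFC.sqrt (fromBlocks P X Xᴴ Q)
  have hS : S * Sᴴ = fromBlocks P X Xᴴ Q := by rw [conjTranspose_sqrt, h.sqrt_mul_sqrt]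
  -- the two block rows of the square root factor `P`, `Q` and `X`
  set A : Matrix n (n ⊕ n) ℂ := S.submatrix Sum.inl id
  set B : Matrix n (n ⊕ n) ℂ := S.submatrix Sum.inr id
  have hA : P = A * Aᴴ := by
    ext i j; exact (congrFun (congrFun hS (Sum.inl i)) (Sum.inl j)).symm
  have hB : Q = B * Bᴴ := by
    ext i j; exact (congrFun (congrFun hS (Sum.inr i)) (Sum.inr j)).symm
  have hX : X = A * Bᴴ := by
    ext i j; exact (congrFun (congrFun hS (Sum.inl i)) (Sum.inr j)).symm
  obtain ⟨V, hV, hAV⟩ := exists_isContraction_of_mul_conjTranspose_eq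
    (M := CFC.sqrt P) (N := A) (by rw [conjTranspose_sqrt, hP.sqrt_mul_sqrt, hA])
  obtain ⟨W, hW, hBW⟩ := exists_isContraction_of_mul_conjTranspose_eq
    (M := CFC.sqrt Q) (N := B) (by rw [conjTranspose_sqrt, hQ.sqrt_mul_sqrt, hB])
  set H := CFC.sqrt (CFC.sqrt P * Q * CFC.sqrt P)
  obtain ⟨U, hU, hHU⟩ := exists_isContraction_of_mul_conjTranspose_eq
    (M := H) (N := CFC.sqrt P * CFC.sqrt Q)
    (by rw [conjTranspose_sqrt, sqrt_mul_sqrt_conj hQ])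
  have e : X.trace = (V * Wᴴ * Uᴴ * H).trace := by
    have h1 : CFC.sqrt Q * CFC.sqrt P = Uᴴ * H := by
      have := congrArg Matrix.conjTranspose hHU
      rwa [conjTranspose_mul, conjTranspose_mul, conjTranspose_sqrt, conjTranspose_sqrt,
        conjTranspose_sqrt] at this
    rw [hX, hBW, hAV, conjTranspose_mul, conjTranspose_sqrt, Matrix.mul_assoc (V * Wᴴ), ← h1,
      Matrix.mul_assoc, trace_mul_comm]
    simp only [Matrix.mul_assoc]
  rw [e]
  exact re_trace_mul_le_re_trace ((hV.mul hW.conjTranspose).mul hU.conjTranspose)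
    (posSemidef_sqrt _)

/-- The bound `re_trace_le_fidelity` is attained: the off-diagonal block is `√P K √Q` with `K` from the
polar decomposition of `√P √Q`. -/
theorem exists_isContraction_trace_eq_fidelity {P Q : Matrix n n ℂ} (hQ : Q.PosSemidef) :
    ∃ K : Matrix n n ℂ, IsContraction K ∧
      (CFC.sqrt P * K * CFC.sqrt Q).trace.re = fidelity P Q := by
  obtain ⟨U, hU, hHU⟩ := exists_isContraction_of_mul_conjTranspose_eq
    (M := CFC.sqrt P * CFC.sqrt Q) (N := CFC.sqrt (CFC.sqrt P * Q * CFC.sqrt P))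
    (by rw [conjTranspose_sqrt (CFC.sqrt P * Q * CFC.sqrt P), sqrt_mul_sqrt_conj hQ])
  refine ⟨Uᴴ, hU.conjTranspose, ?_⟩
  rw [fidelity]
  congr 1
  have h1 := congrArg Matrix.conjTranspose hHU
  rw [conjTranspose_sqrt, conjTranspose_mul, conjTranspose_mul, conjTranspose_sqrt,
    conjTranspose_sqrt] at h1
  rw [h1, Matrix.mul_assoc, trace_mul_comm, Matrix.mul_assoc]

theorem posSemidef_fromBlocks_of_factor (M : Matrix m k ℂ) (N : Matrix n k ℂ) :
    (fromBlocks (M * Mᴴ) (M * Nᴴ) (M * Nᴴ)ᴴ (N * Nᴴ)).PosSemidef := by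
  have h := posSemidef_self_mul_conjTranspose (fromRows M N)
  rw [conjTranspose_fromRows_eq_fromCols_conjTranspose, fromRows_mul_fromCols] at h
  rwa [conjTranspose_mul, conjTranspose_conjTranspose]

theorem posSemidef_fromBlocks_diagonal {P : Matrix m m ℂ} {Q : Matrix n n ℂ}
    (hP : P.PosSemidef) (hQ : Q.PosSemidef) : (fromBlocks P 0 0 Q).PosSemidef := by
  refine .of_dotProduct_mulVec_nonneg (by
    rw [IsHermitian, fromBlocks_conjTranspose, hP.isHermitian.eq, hQ.isHermitian.eq]; simp)
    fun x => ?_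
  obtain ⟨y, z, rfl⟩ : ∃ y z, x = Sum.elim y z := ⟨x ∘ Sum.inl, x ∘ Sum.inr, by ext (_ | _) <;> rfl⟩
  have e : star (Sum.elim y z) = Sum.elim (star y) (star z) := by ext (_ | _) <;> rfl
  rw [fromBlocks_mulVec, e]
  simp only [zero_mulVec, add_zero, zero_add, Sum.elim_comp_inl, Sum.elim_comp_inr,
    sumElim_dotProduct_sumElim]
  exact add_nonneg (hP.dotProduct_mulVec_nonneg y) (hQ.dotProduct_mulVec_nonneg z)

/-- The inequality of Uhlmann's theorem: subnormalized purifications have an overlap of at most the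
fidelity. -/
theorem re_trace_mul_conjTranspose_le_fidelity {Q : Matrix n n ℂ} (M N : Matrix n k ℂ)
    (h : (Q - N * Nᴴ).PosSemidef) : (M * Nᴴ).trace.re ≤ fidelity (M * Mᴴ) Q := by
  refine re_trace_le_fidelity ?_
  have h1 := (posSemidef_fromBlocks_of_factor M N).add
    (posSemidef_fromBlocks_diagonal (P := (0 : Matrix n n ℂ)) PosSemidef.zero h)
  rw [fromBlocks_add] at h1
  simpa using h1

/-- The attaining case of Uhlmann's theorem: the optimal subnormalized purification of `Q` is
obtained from `√Q` by a contraction. -/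
theorem exists_isContraction_trace_mul_eq_fidelity {Q : Matrix n n ℂ} (M : Matrix n k ℂ)
    (hQ : Q.PosSemidef) : ∃ W : Matrix n k ℂ, IsContraction W ∧
      (M * Wᴴ * CFC.sqrt Q).trace.re = fidelity (M * Mᴴ) Q := by
  obtain ⟨K, hK, hKF⟩ := exists_isContraction_trace_eq_fidelity (P := M * Mᴴ) hQ
  obtain ⟨V, hV, hMV⟩ := exists_isContraction_of_mul_conjTranspose_eq
    (M := M) (N := CFC.sqrt (M * Mᴴ))
    (by rw [conjTranspose_sqrt, (posSemidef_self_mul_conjTranspose M).sqrt_mul_sqrt])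
  refine ⟨(V * K)ᴴ, (hV.mul hK).conjTranspose, ?_⟩
  rw [← hKF, conjTranspose_conjTranspose]
  conv_rhs => rw [hMV]
  simp only [Matrix.mul_assoc]

end Fidelity

/-! ### Channels -/

section Channels

variable {k m n : Type*} [Fintype k] [DecidableEq k] [Fintype m] [DecidableEq m]
  [Fintype n] [DecidableEq n]

theorem isChannel_of_kraus {κ : Type*} [Fintype κ] (K : κ → Matrix m n ℂ)
    (h : ∑ i, (K i)ᴴ * K i = 1) : IsChannel fun P : Matrix n n ℂ => ∑ i, K i * P * (K i)ᴴ := by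
  refine ⟨Fintype.card κ, fun i => K ((Fintype.equivFin κ).symm i), ?_, fun P => ?_⟩
  · rw [← h]
    exact Equiv.sum_comp (Fintype.equivFin κ).symm fun i => (K i)ᴴ * K i
  · exact (Equiv.sum_comp (Fintype.equivFin κ).symm fun i => K i * P * (K i)ᴴ).symm

theorem IsChannel.posSemidef {Φ : Matrix n n ℂ → Matrix m m ℂ} (hΦ : IsChannel Φ)
    {P : Matrix n n ℂ} (hP : P.PosSemidef) : (Φ P).PosSemidef := by
  obtain ⟨r, K, -, h⟩ := hΦ
  rw [h]
  exact posSemidef_sum _ fun i _ => hP.mul_mul_conjTranspose_same (K i)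

theorem IsChannel.map_smul_sub {Φ : Matrix n n ℂ → Matrix m m ℂ} (hΦ : IsChannel Φ) (c : ℂ)
    (P Q : Matrix n n ℂ) : Φ (c • Q - P) = c • Φ Q - Φ P := by
  obtain ⟨r, K, -, h⟩ := hΦ
  simp only [h, Matrix.mul_sub, Matrix.sub_mul, Finset.sum_sub_distrib, Finset.smul_sum,
    Matrix.mul_smul, Matrix.smul_mul]

theorem IsChannel.trace_apply {Φ : Matrix n n ℂ → Matrix m m ℂ} (hΦ : IsChannel Φ)
    (P : Matrix n n ℂ) : (Φ P).trace = P.trace := by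
  obtain ⟨r, K, hK, h⟩ := hΦ
  rw [h, trace_sum]
  calc ∑ i, (K i * P * (K i)ᴴ).trace = ∑ i, ((K i)ᴴ * K i * P).trace :=
        Finset.sum_congr rfl fun i _ => by
          rw [trace_mul_comm, Matrix.mul_assoc]
    _ = P.trace := by rw [← trace_sum, ← Finset.sum_mul, hK, Matrix.one_mul]

theorem fidelity_le_fidelity_of_isChannel {Φ : Matrix n n ℂ → Matrix m m ℂ} (hΦ : IsChannel Φ)
    {P Q : Matrix n n ℂ} (hP : P.PosSemidef) (hQ : Q.PosSemidef) :
    fidelity P Q ≤ fidelity (Φ P) (Φ Q) := by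
  obtain ⟨U, hU, hF⟩ := exists_isContraction_trace_eq_fidelity (P := P) hQ
  have hQN : (Q - CFC.sqrt Q * Uᴴ * (CFC.sqrt Q * Uᴴ)ᴴ).PosSemidef := by
    have h1 := PosSemidef.mul_mul_conjTranspose_same hU (CFC.sqrt Q)
    rw [conjTranspose_sqrt, Matrix.mul_sub, Matrix.sub_mul, Matrix.mul_one,
      hQ.sqrt_mul_sqrt] at h1
    rw [conjTranspose_mul, conjTranspose_conjTranspose, conjTranspose_sqrt]
    simpa only [Matrix.mul_assoc] using h1
  have hPM : CFC.sqrt P * (CFC.sqrt P)ᴴ = P := by rw [conjTranspose_sqrt, hP.sqrt_mul_sqrt]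
  have hX : CFC.sqrt P * (CFC.sqrt Q * Uᴴ)ᴴ = CFC.sqrt P * U * CFC.sqrt Q := by
    rw [conjTranspose_mul, conjTranspose_conjTranspose, conjTranspose_sqrt, Matrix.mul_assoc]
  set M := CFC.sqrt P
  set N := CFC.sqrt Q * Uᴴ
  have hpos := hΦ.posSemidef hQN
  have htr := hΦ.trace_apply (M * Nᴴ)
  have hsub := hΦ.map_smul_sub 1 (N * Nᴴ) Q
  rw [one_smul, one_smul] at hsub
  obtain ⟨r, K, -, h⟩ := hΦ
  -- the channel acts on a factor by stacking the products with the Kraus operators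
  have hst : ∀ A B : Matrix n n ℂ,
      (Matrix.of fun x (y : Fin r × n) => (K y.1 * A) x y.2) *
        (Matrix.of fun x (y : Fin r × n) => (K y.1 * B) x y.2)ᴴ = Φ (A * Bᴴ) := by
    intro A B
    have h2 : Φ (A * Bᴴ) = ∑ i, K i * A * (K i * B)ᴴ := by
      rw [h]
      simp only [conjTranspose_mul, Matrix.mul_assoc]
    rw [h2]
    ext x y
    simp only [Matrix.mul_apply' (M := Matrix.of _), Matrix.sum_apply, dotProduct,
      Fintype.sum_prod_type]
    simp only [Matrix.mul_apply (M := K _ * A), conjTranspose_apply, of_apply]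
  have h3 := re_trace_mul_conjTranspose_le_fidelity (Q := Φ Q)
    (Matrix.of fun x (y : Fin r × n) => (K y.1 * M) x y.2)
    (Matrix.of fun x (y : Fin r × n) => (K y.1 * N) x y.2) (by rwa [hst, ← hsub])
  rw [hst, hst, htr, hPM, hX, hF] at h3
  exact h3

end Channels

/-! ### Logarithms to a fixed base -/

section Logarithm

variable {β : ℝ}

theorem logBase_strictMono (hβ : 1 < β) : StrictMono (logBase β) := fun _ _ h =>
  EReal.strictMono_div_right_of_pos (EReal.coe_pos.mpr (Real.log_pos hβ)) (EReal.coe_ne_top _)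
    (ENNReal.log_strictMono h)

theorem logBase_ofReal_rpow (hβ : 1 < β) (x : ℝ) :
    logBase β (ENNReal.ofReal (β ^ x)) = x := by
  have h0 : 0 < β := by linarith
  have hl := Real.log_pos hβ
  rw [logBase, ENNReal.log_ofReal_of_pos (Real.rpow_pos_of_pos h0 x), Real.log_rpow h0,
    ← EReal.coe_div, mul_div_cancel_right₀ _ hl.ne']

theorem neg_Dfid_eq_logBase_sq {n : Type u} [Fintype n] [DecidableEq n] (P Q : Matrix n n ℂ) :
    -Dfid β n P Q = logBase β (ENNReal.ofReal (fidelity P Q ^ 2)) := by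
  have : Dfid β n P Q = -2 * logBase β (ENNReal.ofReal (fidelity P Q)) := rfl
  rw [this, EReal.neg_mul, neg_neg, ENNReal.ofReal_pow (fidelity_nonneg P Q), logBase, logBase,
    ENNReal.log_pow, EReal.mul_div]
  rfl

end Logarithm

/-! ### Monotone relative entropies -/

section RelEnt

variable {D : RelEnt.{u}} {m n : Type u} [Fintype m] [DecidableEq m] [Fintype n] [DecidableEq n]

/-- A relative entropy that ignores null subspaces is antitone in its second argument: the excess
`Q' - Q` can be moved to a null subspace, from which a channel adds it to `Q`. -/
theorem ChannelMonotone.anti_right (hD : ChannelMonotone D) (hN : NullSubspaceInvariant D)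
    {P Q Q' : Matrix n n ℂ} (hP : P.PosSemidef) (hQ : Q.PosSemidef) (h : (Q' - Q).PosSemidef) :
    D n P Q' ≤ D n P Q := by
  let K : Bool → Matrix n (n ⊕ n) ℂ := fun i => cond i (fromCols 1 0) (fromCols 0 1)
  have hK : ∑ i, (K i)ᴴ * K i = 1 := by
    simp only [K, Fintype.sum_bool, cond_true, cond_false]
    rw [conjTranspose_fromCols_eq_fromRows_conjTranspose,
      conjTranspose_fromCols_eq_fromRows_conjTranspose, fromRows_mul_fromCols,
      fromRows_mul_fromCols, fromBlocks_add]
    simp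
  have hΦ : ∀ A B : Matrix n n ℂ, ∑ i, K i * fromBlocks A 0 0 B * (K i)ᴴ = A + B := by
    intro A B
    simp only [K, Fintype.sum_bool, cond_true, cond_false]
    rw [conjTranspose_fromCols_eq_fromRows_conjTranspose,
      conjTranspose_fromCols_eq_fromRows_conjTranspose, fromCols_mul_fromBlocks,
      fromCols_mul_fromBlocks, fromCols_mul_fromRows, fromCols_mul_fromRows]
    simp
  have h1 := hD _ _ _ (isChannel_of_kraus K hK) (fromBlocks P 0 0 0) (fromBlocks Q 0 0 (Q' - Q))
    (posSemidef_fromBlocks_diagonal hP PosSemidef.zero) (posSemidef_fromBlocks_diagonal hQ h)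
  rwa [hΦ, hΦ, hN n n P Q (Q' - Q) hP hQ h, add_zero, add_sub_cancel] at h1

theorem ChannelMonotone.isometry_le (hD : ChannelMonotone D) {P Q : Matrix n n ℂ}
    (hP : P.PosSemidef) (hQ : Q.PosSemidef) {V : Matrix m n ℂ} (hV : Vᴴ * V = 1) :
    D m (V * P * Vᴴ) (V * Q * Vᴴ) ≤ D n P Q := by
  have h := hD _ _ _ (isChannel_of_kraus (fun _ : Unit => V) (by simpa using hV)) P Q hP hQ
  simpa using h

/-- Compressing to the range of an isometry `V` does not increase the relative entropy to a state
supported there, since the complement of the range becomes a null subspace. -/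
theorem ChannelMonotone.compress_le (hD : ChannelMonotone D) (hN : NullSubspaceInvariant D)
    {P : Matrix n n ℂ} {Q : Matrix m m ℂ} (hP : P.PosSemidef) (hQ : Q.PosSemidef)
    {V : Matrix m n ℂ} (hV : Vᴴ * V = 1) :
    D n P (Vᴴ * Q * V) ≤ D m (V * P * Vᴴ) Q := by
  let E : Matrix m m ℂ := 1 - V * Vᴴ
  have hE : Eᴴ = E := by simp [E]
  have hEV : E * V = 0 := by
    simp only [E]
    rw [Matrix.sub_mul, Matrix.mul_assoc, hV, Matrix.mul_one, Matrix.one_mul, sub_self]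
  have hEE : E * E = E := by
    conv_lhs => rw [show E = 1 - V * Vᴴ from rfl]
    rw [← show E = 1 - V * Vᴴ from rfl, Matrix.sub_mul, Matrix.one_mul, Matrix.mul_assoc]
    have : Vᴴ * E = 0 := by rw [← hE, ← conjTranspose_mul, hEV, conjTranspose_zero]
    rw [this, Matrix.mul_zero, sub_zero]
  let K : Bool → Matrix (n ⊕ m) m ℂ := fun i => cond i (fromRows Vᴴ 0) (fromRows 0 E)
  have hK : ∑ i, (K i)ᴴ * K i = 1 := by
    simp only [K, Fintype.sum_bool, cond_true, cond_false]
    rw [conjTranspose_fromRows_eq_fromCols_conjTranspose,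
      conjTranspose_fromRows_eq_fromCols_conjTranspose, fromCols_mul_fromRows,
      fromCols_mul_fromRows]
    simp [hE, hEE, E]
  have hΦ : ∀ A : Matrix m m ℂ, ∑ i, K i * A * (K i)ᴴ =
      fromBlocks (Vᴴ * A * V) 0 0 (E * A * E) := by
    intro A
    simp only [K, Fintype.sum_bool, cond_true, cond_false]
    rw [conjTranspose_fromRows_eq_fromCols_conjTranspose,
      conjTranspose_fromRows_eq_fromCols_conjTranspose, fromRows_mul Vᴴ, fromRows_mul 0 E,
      fromRows_mul_fromCols, fromRows_mul_fromCols, fromBlocks_add]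
    simp [hE]
  have h1 := hD _ _ _ (isChannel_of_kraus K hK) (V * P * Vᴴ) Q (hP.mul_mul_conjTranspose_same V) hQ
  have e1 : Vᴴ * (V * P * Vᴴ) * V = P := by
    rw [Matrix.mul_assoc V, ← Matrix.mul_assoc Vᴴ, hV, Matrix.one_mul, Matrix.mul_assoc, hV,
      Matrix.mul_one]
  have e2 : E * (V * P * Vᴴ) * E = 0 := by
    rw [Matrix.mul_assoc V, ← Matrix.mul_assoc E, hEV, Matrix.zero_mul, Matrix.zero_mul]
  have hE' : (E * Q * E).PosSemidef := by
    have := hQ.mul_mul_conjTranspose_same E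
    rwa [hE] at this
  rwa [hΦ, hΦ, e1, e2, hN _ _ _ _ _ hP (hQ.conjTranspose_mul_mul_same V) hE'] at h1

theorem ereal_neg_iSup {ι : Sort*} (f : ι → EReal) : -(⨆ i, f i) = ⨅ i, -f i :=
  EReal.negOrderIso.map_iSup f

theorem neg_condEntropy_eq_iInf {a b : Type u} [Fintype a] [DecidableEq a] [Fintype b]
    [DecidableEq b] (D : RelEnt.{u}) (ρ : Matrix (a × b) (a × b) ℂ) :
    -condEntropy D a b ρ =
      ⨅ (σ : Matrix b b ℂ) (_ : IsDensity σ), D (a × b) ρ ((1 : Matrix a a ℂ) ⊗ₖ σ) := by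
  simp only [condEntropy, ereal_neg_iSup, neg_neg]

theorem channelMonotone_Dfid {β : ℝ} (hβ : 1 < β) : ChannelMonotone (Dfid.{u} β) := by
  intro n m _ _ _ _ Φ hΦ P Q hP hQ
  rw [← EReal.neg_le_neg_iff, neg_Dfid_eq_logBase_sq, neg_Dfid_eq_logBase_sq]
  refine (logBase_strictMono hβ).monotone (ENNReal.ofReal_le_ofReal ?_)
  exact pow_le_pow_left₀ (fidelity_nonneg P Q) (fidelity_le_fidelity_of_isChannel hΦ hP hQ) 2

theorem sqrt_fromBlocks_zero {P : Matrix n n ℂ} (hP : P.PosSemidef) :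
    CFC.sqrt (fromBlocks P 0 0 (0 : Matrix m m ℂ)) = fromBlocks (CFC.sqrt P) 0 0 0 := by
  refine CFC.sqrt_unique ?_ (Matrix.nonneg_iff_posSemidef.mpr
    (posSemidef_fromBlocks_diagonal (posSemidef_sqrt P) PosSemidef.zero))
  rw [fromBlocks_multiply]
  simp [hP.sqrt_mul_sqrt]

theorem fidelity_fromBlocks {P Q : Matrix n n ℂ} (R : Matrix m m ℂ) (hP : P.PosSemidef)
    (hQ : Q.PosSemidef) :
    fidelity (fromBlocks P 0 0 0) (fromBlocks Q 0 0 R) = fidelity P Q := by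
  have h := hQ.mul_mul_conjTranspose_same (CFC.sqrt P)
  rw [conjTranspose_sqrt] at h
  rw [fidelity, sqrt_fromBlocks_zero hP, fromBlocks_multiply, fromBlocks_multiply]
  simp only [Matrix.mul_zero, Matrix.zero_mul, add_zero]
  rw [sqrt_fromBlocks_zero h, fidelity]
  simp [trace, Fintype.sum_sum_type]

theorem nullSubspaceInvariant_Dfid (β : ℝ) : NullSubspaceInvariant (Dfid.{u} β) := by
  intro n m _ _ _ _ P Q R hP hQ _
  rw [← neg_inj, neg_Dfid_eq_logBase_sq, neg_Dfid_eq_logBase_sq, fidelity_fromBlocks R hP hQ]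

theorem channelMonotone_Dmax {β : ℝ} (hβ : 1 < β) : ChannelMonotone (Dmax.{u} β) := by
  intro n m _ _ _ _ Φ hΦ P Q hP hQ
  refine (logBase_strictMono hβ).monotone (iInf_mono fun l => iInf_mono' fun h => ⟨?_, le_rfl⟩)
  have := hΦ.posSemidef h
  rwa [hΦ.map_smul_sub] at this

theorem nullSubspaceInvariant_Dmax (β : ℝ) : NullSubspaceInvariant (Dmax.{u} β) := by
  intro n m _ _ _ _ P Q R hP hQ hR
  refine congrArg (logBase β) (iInf_congr fun l => iInf_congr_Prop ?_ fun _ => rfl)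
  have e : ((l : ℝ) : ℂ) • fromBlocks Q 0 0 R - fromBlocks P 0 0 0 =
      fromBlocks (((l : ℝ) : ℂ) • Q - P) 0 0 (((l : ℝ) : ℂ) • R) := by
    rw [fromBlocks_smul, sub_eq_add_neg, fromBlocks_neg, fromBlocks_add]
    simp [sub_eq_add_neg]
  rw [e]
  exact ⟨fun h => h.submatrix Sum.inl, fun h => posSemidef_fromBlocks_diagonal h
    (hR.smul (Complex.zero_le_real.mpr l.coe_nonneg))⟩

end RelEnt

/-! ### Purifications -/

section Purifications

variable {a b c d : Type*} [Fintype a] [DecidableEq a] [Fintype b] [DecidableEq b]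
  [Fintype c] [DecidableEq c] [Fintype d] [DecidableEq d]

/-- The amplitudes of a vector on `a × c`, as a matrix from `c` to `a`. -/
def ampRight (φ : EuclideanSpace ℂ (a × c)) : Matrix a c ℂ :=
  Matrix.of fun x z => φ (x, z)

/-- The amplitudes of a vector on `a × b × c`, as a matrix from `b` to `a × c`. -/
def ampMiddle (φ : EuclideanSpace ℂ ((a × b) × c)) : Matrix (a × c) b ℂ :=
  Matrix.of fun x y => φ ((x.1, y), x.2)

/-- The vector on `a × c × b` obtained from a vector on `a × b × c` by swapping two systems. -/
def swapVector (φ : EuclideanSpace ℂ ((a × b) × c)) : EuclideanSpace ℂ ((a × c) × b) :=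
  WithLp.toLp 2 fun x => φ ((x.1.1, x.2), x.1.2)

theorem traceRight_ketbra (φ : EuclideanSpace ℂ (a × c)) :
    traceRight (ketbra φ) = ampRight φ * (ampRight φ)ᴴ := by
  ext i j
  simp [traceRight, ketbra, ampRight, Matrix.mul_apply]

theorem traceMiddle_ketbra (φ : EuclideanSpace ℂ ((a × b) × c)) :
    traceMiddle (ketbra φ) = ampMiddle φ * (ampMiddle φ)ᴴ := by
  ext i j
  simp [traceMiddle, ketbra, ampMiddle, Matrix.mul_apply]

theorem traceRight_ketbra_swapVector (φ : EuclideanSpace ℂ ((a × b) × c)) :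
    traceRight (ketbra (swapVector φ)) = traceMiddle (ketbra φ) := rfl

theorem traceMiddle_ketbra_swapVector (φ : EuclideanSpace ℂ ((a × b) × c)) :
    traceMiddle (ketbra (swapVector φ)) = traceRight (ketbra φ) := rfl

theorem trace_traceMiddle_ketbra (φ : EuclideanSpace ℂ ((a × b) × c)) :
    (traceMiddle (ketbra φ)).trace = (traceRight (ketbra φ)).trace := by
  simp only [trace, diag_apply, traceMiddle, traceRight, of_apply, Fintype.sum_prod_type]
  exact Finset.sum_congr rfl fun i _ => Finset.sum_comm

theorem posSemidef_traceRight_ketbra (φ : EuclideanSpace ℂ (a × c)) :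
    (traceRight (ketbra φ)).PosSemidef := by
  rw [traceRight_ketbra]
  exact posSemidef_self_mul_conjTranspose _

theorem isDensity_traceMiddle_ketbra {φ : EuclideanSpace ℂ ((a × b) × c)}
    (h : IsDensity (traceRight (ketbra φ))) : IsDensity (traceMiddle (ketbra φ)) :=
  ⟨posSemidef_traceRight_ketbra (swapVector φ), by rw [trace_traceMiddle_ketbra, h.2]⟩

/-- Any two purifications of a state on `a × b` are related by a contraction of the purifying
systems. -/
theorem exists_isContraction_traceMiddle_eq {φ : EuclideanSpace ℂ ((a × b) × c)}
    {χ : EuclideanSpace ℂ ((a × b) × d)}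
    (h : traceRight (ketbra φ) = traceRight (ketbra χ)) :
    ∃ W : Matrix d c ℂ, IsContraction W ∧ traceMiddle (ketbra χ) =
      ((1 : Matrix a a ℂ) ⊗ₖ W) * traceMiddle (ketbra φ) * ((1 : Matrix a a ℂ) ⊗ₖ W)ᴴ := by
  rw [traceRight_ketbra, traceRight_ketbra] at h
  obtain ⟨V, hV, e⟩ := exists_isContraction_of_mul_conjTranspose_eq h
  refine ⟨Vᵀ, ?_, ?_⟩
  · have h1 := (isContraction_iff_posSemidef_one_sub_mul_conjTranspose.mp hV).transpose
    unfold IsContraction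
    rwa [transpose_sub, transpose_one, transpose_mul] at h1
  · have h2 : ampMiddle χ = ((1 : Matrix a a ℂ) ⊗ₖ Vᵀ) * ampMiddle φ := by
      ext ⟨i, k⟩ j
      have h3 := congrFun (congrFun e (i, j)) k
      simp only [ampRight, Matrix.mul_apply, of_apply] at h3
      simp only [ampMiddle, of_apply, Matrix.mul_apply, kroneckerMap_apply, Fintype.sum_prod_type,
        transpose_apply, h3, one_apply]
      rw [Finset.sum_eq_single i]
      · simp [mul_comm]
      · intro x _ hx
        simp [hx.symm]
      · simp
    rw [traceMiddle_ketbra, traceMiddle_ketbra, h2, conjTranspose_mul]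
    simp only [Matrix.mul_assoc]

theorem IsDensity.nonempty {ρ : Matrix a a ℂ} (h : IsDensity ρ) : Nonempty a := by
  by_contra hn
  rw [not_nonempty_iff] at hn
  have := h.2
  simp [trace] at this

end Purifications

/-! ### Dual entropies -/

section Duality

variable {D : RelEnt.{u}} {a b c d : Type u} [Fintype a] [DecidableEq a] [Fintype b]
  [DecidableEq b] [Fintype c] [DecidableEq c] [Fintype d] [DecidableEq d]

theorem one_kronecker_conj (K : Matrix d c ℂ) (σ : Matrix c c ℂ) :
    ((1 : Matrix a a ℂ) ⊗ₖ K) * ((1 : Matrix a a ℂ) ⊗ₖ σ) * ((1 : Matrix a a ℂ) ⊗ₖ K)ᴴ =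
      (1 : Matrix a a ℂ) ⊗ₖ (K * σ * Kᴴ) := by
  rw [conjTranspose_kronecker, ← mul_kronecker_mul, ← mul_kronecker_mul, conjTranspose_one,
    Matrix.one_mul, Matrix.one_mul]

theorem sum_one_kronecker {κ : Type*} [Fintype κ] (f : κ → Matrix c d ℂ) :
    ∑ i, (1 : Matrix a a ℂ) ⊗ₖ f i = (1 : Matrix a a ℂ) ⊗ₖ ∑ i, f i := by
  ext x y
  simp [Matrix.sum_apply, Finset.mul_sum]

theorem isChannel_one_kronecker {κ : Type*} [Fintype κ] (K : κ → Matrix d c ℂ)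
    (hK : ∑ i, (K i)ᴴ * K i = 1) :
    IsChannel fun ρ : Matrix (a × c) (a × c) ℂ =>
      ∑ i, ((1 : Matrix a a ℂ) ⊗ₖ K i) * ρ * ((1 : Matrix a a ℂ) ⊗ₖ K i)ᴴ := by
  refine isChannel_of_kraus _ ?_
  simp only [conjTranspose_kronecker, ← mul_kronecker_mul, conjTranspose_one, Matrix.one_mul]
  rw [sum_one_kronecker, hK, one_kronecker_one]

/-- Data processing on the conditioning system. -/
theorem condEntropy_le_of_kraus (hD : ChannelMonotone D) {κ : Type*} [Fintype κ]
    (K : κ → Matrix d c ℂ) (hK : ∑ i, (K i)ᴴ * K i = 1) {ρ : Matrix (a × c) (a × c) ℂ}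
    (hρ : ρ.PosSemidef) :
    condEntropy D a c ρ ≤ condEntropy D a d
      (∑ i, ((1 : Matrix a a ℂ) ⊗ₖ K i) * ρ * ((1 : Matrix a a ℂ) ⊗ₖ K i)ᴴ) := by
  have hΦ := isChannel_of_kraus K hK
  refine iSup₂_le fun σ hσ => le_iSup₂_of_le (∑ i, K i * σ * (K i)ᴴ)
    ⟨hΦ.posSemidef hσ.1, (hΦ.trace_apply σ).trans hσ.2⟩ ?_
  rw [EReal.neg_le_neg_iff]
  have h := hD _ _ _ (isChannel_one_kronecker K hK) ρ ((1 : Matrix a a ℂ) ⊗ₖ σ) hρ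
    (PosSemidef.one.kronecker hσ.1)
  simpa only [one_kronecker_conj, sum_one_kronecker] using h

/-- A contraction of the conditioning system that loses no weight extends to a channel, which maps
the lost part of other states to a fixed basis state. -/
theorem condEntropy_le_of_isContraction (hD : ChannelMonotone D) [Nonempty d] {W : Matrix d c ℂ}
    (hW : IsContraction W) {ρ : Matrix (a × c) (a × c) ℂ} (hρ : ρ.PosSemidef)
    (htr : (((1 : Matrix a a ℂ) ⊗ₖ W) * ρ * ((1 : Matrix a a ℂ) ⊗ₖ W)ᴴ).trace = ρ.trace) :
    condEntropy D a c ρ ≤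
      condEntropy D a d (((1 : Matrix a a ℂ) ⊗ₖ W) * ρ * ((1 : Matrix a a ℂ) ⊗ₖ W)ᴴ) := by
  obtain ⟨z⟩ := ‹Nonempty d›
  set S := CFC.sqrt (1 - Wᴴ * W)
  have hS : Sᴴ = S := conjTranspose_sqrt _
  have hSS : S * S = 1 - Wᴴ * W := PosSemidef.sqrt_mul_sqrt hW
  let K : Option c → Matrix d c ℂ := fun i => i.elim W fun k => Matrix.single z k (1 : ℂ) * S
  have hK : ∑ i, (K i)ᴴ * K i = 1 := by
    have h1 : ∀ k, (Matrix.single z k (1 : ℂ) * S)ᴴ * (Matrix.single z k (1 : ℂ) * S) =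
        S * (Matrix.single k k (1 : ℂ) * S) := fun k => by
      rw [conjTranspose_mul, hS, conjTranspose_single, Matrix.mul_assoc,
        ← Matrix.mul_assoc (Matrix.single k z _), single_mul_single_same]
      simp
    simp only [K, Fintype.sum_option, Option.elim, h1]
    rw [← Finset.mul_sum, ← Finset.sum_mul, Matrix.sum_single_one, Matrix.one_mul, hSS]
    exact add_sub_cancel _ _
  have h := condEntropy_le_of_kraus (a := a) hD K hK hρ
  have h0 : ∑ k : c, ((1 : Matrix a a ℂ) ⊗ₖ (Matrix.single z k (1 : ℂ) * S)) * ρ *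
      ((1 : Matrix a a ℂ) ⊗ₖ (Matrix.single z k (1 : ℂ) * S))ᴴ = 0 := by
    refine (PosSemidef.trace_eq_zero_iff
      (posSemidef_sum _ fun k _ => hρ.mul_mul_conjTranspose_same _)).mp ?_
    have ht := (isChannel_one_kronecker (a := a) K hK).trace_apply ρ
    simp only [K, Fintype.sum_option, Option.elim] at ht
    rwa [trace_add, htr, add_eq_left] at ht
  simp only [K, Fintype.sum_option, Option.elim, h0, add_zero] at h
  exact h

theorem condEntropy_traceMiddle_le (hD : ChannelMonotone D) {φ : EuclideanSpace ℂ ((a × b) × c)}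
    {χ : EuclideanSpace ℂ ((a × b) × d)} (hφ : IsDensity (traceRight (ketbra φ)))
    (h : traceRight (ketbra φ) = traceRight (ketbra χ)) :
    condEntropy D a c (traceMiddle (ketbra φ)) ≤ condEntropy D a d (traceMiddle (ketbra χ)) := by
  obtain ⟨W, hW, e⟩ := exists_isContraction_traceMiddle_eq h
  have hφ' := isDensity_traceMiddle_ketbra hφ
  have hχ' := isDensity_traceMiddle_ketbra (h ▸ hφ)
  obtain ⟨-, z⟩ := hχ'.nonempty.some
  have : Nonempty d := ⟨z⟩
  rw [e]
  exact condEntropy_le_of_isContraction hD hW hφ'.1 (by rw [← e, hχ'.2, hφ'.2])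

/-- The dual entropy does not depend on the purification. -/
theorem dualEntropy_eq (hD : ChannelMonotone D) {ρ : Matrix (a × b) (a × b) ℂ}
    {φ : EuclideanSpace ℂ ((a × b) × c)} (hρ : IsDensity ρ) (hφ : IsPurification φ ρ) :
    dualEntropy D a b ρ = -condEntropy D a c (traceMiddle (ketbra φ)) := by
  have h := isPurification_canonicalPurification hρ.1
  unfold IsPurification at h hφ
  rw [dualEntropy, neg_inj]
  exact le_antisymm (condEntropy_traceMiddle_le hD (h.symm ▸ hρ) (h.trans hφ.symm))
    (condEntropy_traceMiddle_le hD (hφ.symm ▸ hρ) (hφ.trans h.symm))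

end Duality

/-! ### Separable and classical states -/

section ClassesOfStates

variable {a b n : Type*} [Fintype a] [DecidableEq a] [Fintype b] [DecidableEq b]
  [Fintype n] [DecidableEq n]

theorem IsDensity.posSemidef_one_sub {ρ : Matrix n n ℂ} (h : IsDensity ρ) :
    (1 - ρ).PosSemidef := by
  have hh := h.1.isHermitian
  have ht : ∑ i, hh.eigenvalues i = 1 := by
    have := hh.trace_eq_sum_eigenvalues
    rw [h.2] at this
    simpa using (congrArg Complex.re this).symm
  have hle : cfc (fun x : ℝ => x) ρ ≤ 1 := by
    refine cfc_le_one _ _ fun x hx => ?_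
    rw [hh.spectrum_real_eq_range_eigenvalues] at hx
    obtain ⟨i, rfl⟩ := hx
    rw [← ht]
    exact Finset.single_le_sum (fun j _ => h.1.eigenvalues_nonneg j) (Finset.mem_univ i)
  rw [cfc_id' ℝ ρ (show IsSelfAdjoint ρ from hh)] at hle
  exact Matrix.le_iff.mp hle

theorem ketbra_eq_vecMulVec (v : EuclideanSpace ℂ n) : ketbra v = vecMulVec v (star v.ofLp) := rfl

theorem posSemidef_ketbra (v : EuclideanSpace ℂ n) : (ketbra v).PosSemidef :=
  posSemidef_vecMulVec_self_star v.ofLp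

theorem trace_ketbra (v : EuclideanSpace ℂ n) : (ketbra v).trace = inner ℂ v v := by
  rw [EuclideanSpace.inner_eq_star_dotProduct]
  rfl

theorem isDensity_ketbra (f : OrthonormalBasis n ℂ (EuclideanSpace ℂ n)) (i : n) :
    IsDensity (ketbra (f i)) :=
  ⟨posSemidef_ketbra _, by rw [trace_ketbra, f.inner_eq_one]⟩

theorem sum_ketbra (f : OrthonormalBasis n ℂ (EuclideanSpace ℂ n)) :
    ∑ i, ketbra (f i) = 1 := by
  ext x y
  have h := f.sum_inner_mul_inner (EuclideanSpace.single x (1 : ℂ)) (EuclideanSpace.single y 1)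
  simp only [EuclideanSpace.inner_single_left, EuclideanSpace.inner_single_right] at h
  simp only [Matrix.sum_apply, ketbra, of_apply]
  simpa [one_apply, Pi.single_apply, eq_comm (a := x)] using h

/-- A positive semidefinite matrix is its trace times a state; the state `τ` is used if the matrix
vanishes. -/
theorem exists_isDensity_smul_eq {M τ : Matrix n n ℂ} (hM : M.PosSemidef) (hτ : IsDensity τ) :
    ∃ β, IsDensity β ∧ M = (M.trace.re : ℂ) • β := by
  have h0 := Complex.le_def.mp hM.trace_nonneg
  have ht : M.trace = (M.trace.re : ℂ) := Complex.ext rfl (by simpa using h0.2.symm)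
  set t : ℝ := M.trace.re
  rcases eq_or_ne t 0 with h | h
  · refine ⟨τ, hτ, ?_⟩
    rw [h, Complex.ofReal_zero] at ht
    rw [hM.trace_eq_zero_iff.mp ht, h, Complex.ofReal_zero, zero_smul]
  · have h' : (t : ℂ) ≠ 0 := Complex.ofReal_ne_zero.mpr h
    refine ⟨((t⁻¹ : ℝ) : ℂ) • M, ⟨hM.smul (Complex.zero_le_real.mpr (inv_nonneg.mpr h0.1)), ?_⟩, ?_⟩
    · rw [trace_smul, ht, smul_eq_mul, Complex.ofReal_inv, inv_mul_cancel₀ h']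
    · rw [smul_smul, Complex.ofReal_inv, mul_inv_cancel₀ h', one_smul]

theorem CQ_subset_Sep : CQ a b ⊆ Sep a b := by
  rintro _ ⟨f, p, β, hp, hs, hβ, rfl⟩
  refine ⟨Fintype.card a, fun j => p ((Fintype.equivFin a).symm j),
    fun j => ketbra (f ((Fintype.equivFin a).symm j)), fun j => β ((Fintype.equivFin a).symm j),
    fun j => hp _, ?_, fun j => isDensity_ketbra f _, fun j => hβ _, ?_⟩
  · rw [← hs]
    exact Equiv.sum_comp (Fintype.equivFin a).symm p
  · exact (Equiv.sum_comp (Fintype.equivFin a).symm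
      fun j => (p j : ℂ) • (ketbra (f j) ⊗ₖ β j)).symm

theorem QC_subset_Sep : QC a b ⊆ Sep a b := by
  rintro _ ⟨f, p, α, hp, hs, hα, rfl⟩
  refine ⟨Fintype.card b, fun j => p ((Fintype.equivFin b).symm j),
    fun j => α ((Fintype.equivFin b).symm j), fun j => ketbra (f ((Fintype.equivFin b).symm j)),
    fun j => hp _, ?_, fun j => hα _, fun j => isDensity_ketbra f _, ?_⟩
  · rw [← hs]
    exact Equiv.sum_comp (Fintype.equivFin b).symm p
  · exact (Equiv.sum_comp (Fintype.equivFin b).symm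
      fun j => (p j : ℂ) • (α j ⊗ₖ ketbra (f j))).symm

/-- A nonnegative combination of basis projectors is a multiple of a state; the index `i` only serves
to exclude the zero-dimensional space, which has no states. -/
theorem exists_isDensity_sum_ketbra (g : OrthonormalBasis n ℂ (EuclideanSpace ℂ n)) (i : n)
    {q : n → ℝ} (hq : ∀ k, 0 ≤ q k) :
    ∃ β, IsDensity β ∧ ∑ k, (q k : ℂ) • ketbra (g k) = ((∑ k, q k : ℝ) : ℂ) • β := by
  have h1 : (∑ k, (q k : ℂ) • ketbra (g k)).PosSemidef :=
    posSemidef_sum _ fun k _ => (posSemidef_ketbra _).smul (Complex.zero_le_real.mpr (hq k))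
  have h2 : (∑ k, (q k : ℂ) • ketbra (g k)).trace = ((∑ k, q k : ℝ) : ℂ) := by
    rw [trace_sum]
    push_cast
    exact Finset.sum_congr rfl fun k _ => by
      rw [trace_smul, (isDensity_ketbra g k).2, smul_eq_mul, mul_one]
  obtain ⟨β, hβ, e⟩ := exists_isDensity_smul_eq h1 (isDensity_ketbra g i)
  exact ⟨β, hβ, by rwa [h2, Complex.ofReal_re] at e⟩

theorem CC_subset_CQ : CC a b ⊆ CQ a b := by
  rintro _ ⟨f, g, p, hp, hs, rfl⟩
  have hne : Nonempty b := by
    by_contra h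
    rw [not_nonempty_iff] at h
    simp at hs
  choose β hβ e using fun j => exists_isDensity_sum_ketbra g hne.some (hp j)
  refine ⟨f, fun j => ∑ k, p j k, β, fun j => Finset.sum_nonneg fun k _ => hp j k, hs, hβ, ?_⟩
  refine Finset.sum_congr rfl fun j _ => ?_
  rw [← kronecker_smul, ← e]
  ext x y
  simp only [Matrix.sum_apply, Matrix.smul_apply, kroneckerMap_apply, smul_eq_mul, Finset.mul_sum]
  exact Finset.sum_congr rfl fun k _ => by ring

theorem CC_subset_QC : CC a b ⊆ QC a b := by
  rintro _ ⟨f, g, p, hp, hs, rfl⟩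
  rw [Finset.sum_comm] at hs
  have hne : Nonempty a := by
    by_contra h
    rw [not_nonempty_iff] at h
    simp at hs
  choose α hα e using fun k => exists_isDensity_sum_ketbra f hne.some fun j => hp j k
  refine ⟨g, fun k => ∑ j, p j k, α, fun k => Finset.sum_nonneg fun j _ => hp j k, hs, hα, ?_⟩
  rw [Finset.sum_comm]
  refine Finset.sum_congr rfl fun k _ => ?_
  rw [← smul_kronecker, ← e]
  ext x y
  simp only [Matrix.sum_apply, Matrix.smul_apply, kroneckerMap_apply, smul_eq_mul, Finset.sum_mul]
  exact Finset.sum_congr rfl fun j _ => by ring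

/-- A separable state is dominated by `1 ⊗ σ`, where `σ` is its second marginal. -/
theorem exists_isDensity_posSemidef_one_kronecker_sub {ω : Matrix (a × b) (a × b) ℂ}
    (h : ω ∈ Sep a b) :
    ω.PosSemidef ∧ ∃ σ, IsDensity σ ∧ ((1 : Matrix a a ℂ) ⊗ₖ σ - ω).PosSemidef := by
  obtain ⟨k, p, α, β, hp, hs, hα, hβ, rfl⟩ := h
  have hp' : ∀ j, (0 : ℂ) ≤ p j := fun j => Complex.zero_le_real.mpr (hp j)
  refine ⟨posSemidef_sum _ fun j _ => ((hα j).1.kronecker (hβ j).1).smul (hp' j),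
    ∑ j, (p j : ℂ) • β j, ⟨posSemidef_sum _ fun j _ => (hβ j).1.smul (hp' j), ?_⟩, ?_⟩
  · rw [trace_sum]
    simp only [trace_smul, (hβ _).2, smul_eq_mul, mul_one]
    exact_mod_cast hs
  · have e : (1 : Matrix a a ℂ) ⊗ₖ (∑ j, (p j : ℂ) • β j) - ∑ j, (p j : ℂ) • (α j ⊗ₖ β j) =
        ∑ j, (p j : ℂ) • ((1 - α j) ⊗ₖ β j) := by
      ext x y
      simp only [Matrix.sum_apply, Matrix.sub_apply, Matrix.smul_apply, kroneckerMap_apply, smul_eq_mul,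
        Finset.mul_sum, ← Finset.sum_sub_distrib]
      exact Finset.sum_congr rfl fun j _ => by ring
    rw [e]
    exact posSemidef_sum _ fun j _ =>
      (((hα j).posSemidef_one_sub).kronecker (hβ j).1).smul (hp' j)

end ClassesOfStates

/-! ### Premeasurement -/

section Premeasurement

variable {ι : Type v} [Fintype ι] {m s e : Type u} [Fintype m] [DecidableEq m]
  [Fintype s] [DecidableEq s] [Fintype e] [DecidableEq e]
  {w : ι → EuclideanSpace ℂ m} {X : ι → Matrix s s ℂ}

theorem IsPVM.conjTranspose_eq (hX : IsPVM X) (j : ι) : (X j)ᴴ = X j :=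
  (hX.isStarProjection j).isSelfAdjoint

theorem IsPVM.mul_self (hX : IsPVM X) (j : ι) : X j * X j = X j :=
  (hX.isStarProjection j).isIdempotentElem

theorem IsPVM.mul_eq [DecidableEq ι] (hX : IsPVM X) (i j : ι) :
    X i * X j = if i = j then X j else 0 := by
  split_ifs with h
  · rw [h, hX.mul_self]
  · exact hX.orthogonal i j h

/-- The branch `|w⟩ ⊗ Y` of a premeasurement. -/
def branch (w : EuclideanSpace ℂ m) (Y : Matrix s s ℂ) : Matrix (m × s) s ℂ :=
  Matrix.of fun x t => w x.1 * Y x.2 t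

theorem premeasIsometry_eq_sum (w : ι → EuclideanSpace ℂ m) (X : ι → Matrix s s ℂ) :
    premeasIsometry w X = ∑ j, branch (w j) (X j) := by
  ext x t
  simp [premeasIsometry, branch, Matrix.sum_apply]

theorem conjTranspose_branch_mul (v w : EuclideanSpace ℂ m) (Y Z σ : Matrix s s ℂ) :
    (branch v Y)ᴴ * ((1 : Matrix m m ℂ) ⊗ₖ σ) * branch w Z =
      (inner ℂ v w : ℂ) • (Yᴴ * σ * Z) := by
  have h : ((1 : Matrix m m ℂ) ⊗ₖ σ) * branch w Z = branch w (σ * Z) := by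
    ext x t
    simp only [branch, Matrix.mul_apply, kroneckerMap_apply, of_apply, Fintype.sum_prod_type,
      one_apply, Finset.mul_sum]
    rw [Finset.sum_eq_single x.1]
    · exact Finset.sum_congr rfl fun y _ => by simp; ring
    · intro y _ hy
      simp [hy.symm]
    · simp
  rw [Matrix.mul_assoc, h, Matrix.mul_assoc]
  ext x t
  simp only [branch, Matrix.mul_apply (M := (of _)ᴴ), conjTranspose_apply, of_apply,
    Fintype.sum_prod_type, Matrix.smul_apply, smul_eq_mul, PiLp.inner_apply, RCLike.inner_apply,
    Matrix.mul_apply (M := Yᴴ), Finset.sum_mul, Finset.mul_sum, star_mul']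
  rw [Finset.sum_comm]
  exact Finset.sum_congr rfl fun y _ => Finset.sum_congr rfl fun z _ => by
    simp only [starRingEnd_apply]; ring

theorem branch_mul_conjTranspose (v w : EuclideanSpace ℂ m) (Y Z σ : Matrix s s ℂ) :
    branch v Y * σ * (branch w Z)ᴴ = vecMulVec v (star w.ofLp) ⊗ₖ (Y * σ * Zᴴ) := by
  have h : branch v Y * σ = branch v (Y * σ) := by
    ext x t
    simp only [branch, Matrix.mul_apply, of_apply, Finset.mul_sum]
    exact Finset.sum_congr rfl fun y _ => by ring
  rw [h]
  ext x t
  simp only [branch, Matrix.mul_apply (N := (of _)ᴴ), Matrix.mul_apply (N := Zᴴ),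
    conjTranspose_apply, of_apply, kroneckerMap_apply, vecMulVec_apply, Finset.mul_sum,
    star_mul', Pi.star_apply]
  exact Finset.sum_congr rfl fun y _ => by ring

theorem premeasIsometry_compress (hw : Orthonormal ℂ w) (hX : IsPVM X) (σ : Matrix s s ℂ) :
    (premeasIsometry w X)ᴴ * ((1 : Matrix m m ℂ) ⊗ₖ σ) * premeasIsometry w X =
      ∑ j, X j * σ * X j := by
  classical
  rw [premeasIsometry_eq_sum, conjTranspose_sum, Matrix.sum_mul, Matrix.sum_mul]
  refine Finset.sum_congr rfl fun i _ => ?_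
  rw [Matrix.mul_sum]
  simp only [conjTranspose_branch_mul, orthonormal_iff_ite.mp hw, hX.conjTranspose_eq]
  simp

theorem premeasIsometry_isometry (hw : Orthonormal ℂ w) (hX : IsPVM X) :
    (premeasIsometry w X)ᴴ * premeasIsometry w X = 1 := by
  have h := premeasIsometry_compress hw hX 1
  simpa [hX.mul_self, hX.sum_eq_one] using h

theorem premeasState_pinch (hX : IsPVM X) (σ : Matrix s s ℂ) :
    premeasState w X (∑ j, X j * σ * X j) = ∑ j, ketbra (w j) ⊗ₖ (X j * σ * X j) := by
  classical
  have h : ∀ i j, X i * (∑ k, X k * σ * X k) * X j = if i = j then X j * σ * X j else 0 := by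
    intro i j
    rw [Finset.mul_sum, Finset.sum_mul, Finset.sum_eq_single i]
    · rw [← Matrix.mul_assoc, ← Matrix.mul_assoc, hX.mul_self, Matrix.mul_assoc, hX.mul_eq]
      split_ifs with hij
      · rw [hij]
      · rw [Matrix.mul_zero]
    · intro k _ hk
      rw [← Matrix.mul_assoc, ← Matrix.mul_assoc, hX.orthogonal i k hk.symm]
      simp
    · simp
  rw [premeasState, premeasIsometry_eq_sum, conjTranspose_sum, Matrix.sum_mul, Matrix.sum_mul]
  refine Finset.sum_congr rfl fun i _ => ?_
  rw [Matrix.mul_sum]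
  simp only [branch_mul_conjTranspose, hX.conjTranspose_eq, h]
  rw [Finset.sum_eq_single i]
  · simp [ketbra_eq_vecMulVec]
  · intro j _ hj
    simp [hj.symm]
  · simp

/-- A state that is block diagonal for the measurement has an eigenbasis that is adapted to the
blocks. -/
theorem IsPVM.exists_adapted_basis (hX : IsPVM X) {τ : Matrix s s ℂ} (hτ : IsDensity τ)
    (hc : ∀ j, X j * τ = τ * X j) :
    ∃ (g : OrthonormalBasis s ℂ (EuclideanSpace ℂ s)) (J : s → ι) (μ : s → ℝ),
      (∀ k, 0 ≤ μ k) ∧ (∀ k, X (J k) *ᵥ (g k).ofLp = (g k).ofLp) ∧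
        ∀ k, τ *ᵥ (g k).ofLp = (μ k : ℂ) • (g k).ofLp := by
  classical
  -- As `0 ≤ τ ≤ 1`, an eigenvalue of `A` determines the block of the eigenvector.
  let c : ι → ℝ := fun j => 2 * (Fintype.equivFin ι j : ℕ)
  have hcj : ∀ i j, |c i - c j| ≤ 1 → i = j := by
    intro i j h
    rw [abs_le] at h
    have h1 : ((Fintype.equivFin ι i : ℕ) : ℝ) < (Fintype.equivFin ι j : ℕ) + 1 := by
      simp only [c] at h; linarith
    have h2 : ((Fintype.equivFin ι j : ℕ) : ℝ) < (Fintype.equivFin ι i : ℕ) + 1 := by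
      simp only [c] at h; linarith
    have h3 : (Fintype.equivFin ι i : ℕ) < (Fintype.equivFin ι j : ℕ) + 1 := by exact_mod_cast h1
    have h4 : (Fintype.equivFin ι j : ℕ) < (Fintype.equivFin ι i : ℕ) + 1 := by exact_mod_cast h2
    exact (Fintype.equivFin ι).injective (Fin.ext (by omega))
  let A : Matrix s s ℂ := τ + ∑ j, (c j : ℂ) • X j
  have hA : A.IsHermitian := by
    simp [IsHermitian, A, conjTranspose_sum, conjTranspose_smul, hX.conjTranspose_eq,
      hτ.1.isHermitian.eq]
  have hXA : ∀ j, X j * A = τ * X j + (c j : ℂ) • X j := by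
    intro j
    simp only [A, Matrix.mul_add, hc, Finset.mul_sum, Matrix.mul_smul, hX.mul_eq]
    simp
  set g := hA.eigenvectorBasis
  have hgA : ∀ k, A *ᵥ (g k).ofLp = (hA.eigenvalues k : ℂ) • (g k).ofLp :=
    fun k => hA.mulVec_eigenvectorBasis k
  have hτX : ∀ k j, τ *ᵥ (X j *ᵥ (g k).ofLp) =
      ((hA.eigenvalues k - c j : ℝ) : ℂ) • (X j *ᵥ (g k).ofLp) := by
    intro k j
    have h1 : X j *ᵥ (A *ᵥ (g k).ofLp) = (hA.eigenvalues k : ℂ) • (X j *ᵥ (g k).ofLp) := by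
      rw [hgA, mulVec_smul]
    rw [mulVec_mulVec, hXA, add_mulVec, smul_mulVec, ← mulVec_mulVec] at h1
    rw [Complex.ofReal_sub, sub_smul, ← h1, add_sub_cancel_right]
  have hbd : ∀ k j, X j *ᵥ (g k).ofLp ≠ 0 →
      0 ≤ hA.eigenvalues k - c j ∧ hA.eigenvalues k - c j ≤ 1 := by
    intro k j hne
    have h1 := hτ.1.dotProduct_mulVec_nonneg (X j *ᵥ (g k).ofLp)
    have h2 := hτ.posSemidef_one_sub.dotProduct_mulVec_nonneg (X j *ᵥ (g k).ofLp)
    have h3 : 0 < star (X j *ᵥ (g k).ofLp) ⬝ᵥ (X j *ᵥ (g k).ofLp) :=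
      dotProduct_star_self_pos_iff.mpr hne
    rw [sub_mulVec, one_mulVec, hτX, dotProduct_sub, dotProduct_smul, smul_eq_mul] at h2
    rw [hτX, dotProduct_smul, smul_eq_mul] at h1
    obtain ⟨h3, h3'⟩ := Complex.lt_def.mp h3
    have h1' := (Complex.le_def.mp h1).1
    have h2' := (Complex.le_def.mp h2).1
    rw [Complex.sub_re, Complex.re_ofReal_mul] at h2'
    rw [Complex.re_ofReal_mul] at h1'
    simp only [Complex.zero_re] at h1' h2' h3
    constructor
    · by_contra hlt
      nlinarith
    · by_contra hlt
      nlinarith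
  have hex : ∀ k, ∃ j, X j *ᵥ (g k).ofLp ≠ 0 := by
    intro k
    by_contra hall
    push Not at hall
    have h1 : (∑ j, X j) *ᵥ (g k).ofLp = 0 := by
      rw [sum_mulVec]
      exact Finset.sum_eq_zero fun j _ => hall j
    rw [hX.sum_eq_one, one_mulVec] at h1
    exact g.orthonormal.ne_zero k (by ext i; exact congrFun h1 i)
  choose J hJ using hex
  have hfix : ∀ k, X (J k) *ᵥ (g k).ofLp = (g k).ofLp := by
    intro k
    have h1 : (∑ j, X j) *ᵥ (g k).ofLp = X (J k) *ᵥ (g k).ofLp := by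
      rw [sum_mulVec]
      refine Finset.sum_eq_single _ (fun j _ hj => ?_) (by simp)
      by_contra hne
      refine hj (hcj j (J k) ?_)
      have h2 := hbd k j hne
      have h3 := hbd k (J k) (hJ k)
      rw [abs_le]
      constructor <;> linarith
    rw [← h1, hX.sum_eq_one, one_mulVec]
  refine ⟨g, J, fun k => hA.eigenvalues k - c (J k), fun k => (hbd k _ (hJ k)).1, hfix, fun k => ?_⟩
  have := hτX k (J k)
  rwa [hfix] at this

theorem isDensity_pinch (hX : IsPVM X) {σ : Matrix s s ℂ} (hσ : IsDensity σ) :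
    IsDensity (∑ j, X j * σ * X j) := by
  refine ⟨posSemidef_sum _ fun j _ => ?_, ?_⟩
  · have := hσ.1.mul_mul_conjTranspose_same (X j)
    rwa [hX.conjTranspose_eq] at this
  · rw [trace_sum, ← hσ.2]
    calc ∑ j, (X j * σ * X j).trace = ∑ j, (X j * σ).trace :=
          Finset.sum_congr rfl fun j _ => by
            rw [trace_mul_comm, ← Matrix.mul_assoc, hX.mul_self]
      _ = σ.trace := by rw [← trace_sum, ← Finset.sum_mul, hX.sum_eq_one, Matrix.one_mul]

theorem mul_ketbra (M : Matrix s s ℂ) (v : EuclideanSpace ℂ s) :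
    M * ketbra v = vecMulVec (M *ᵥ v.ofLp) (star v.ofLp) := by
  rw [ketbra_eq_vecMulVec, mul_vecMulVec]

/-- The premeasurement of a block diagonal state is classical on both systems. -/
theorem premeasState_pinch_mem_CC (hw : Orthonormal ℂ w) (hX : IsPVM X) {σ : Matrix s s ℂ}
    (hσ : IsDensity σ) : premeasState w X (∑ j, X j * σ * X j) ∈ CC m s := by
  classical
  set τ := ∑ j, X j * σ * X j with hτdef
  have hτ : IsDensity τ := isDensity_pinch hX hσ
  have hXτ : ∀ j, X j * τ = X j * σ * X j := by
    intro j
    rw [hτdef, Finset.mul_sum, Finset.sum_eq_single j]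
    · rw [← Matrix.mul_assoc, ← Matrix.mul_assoc, hX.mul_self]
    · intro k _ hk
      rw [← Matrix.mul_assoc, ← Matrix.mul_assoc, hX.orthogonal j k hk.symm]
      simp
    · simp
  have hτX : ∀ j, τ * X j = X j * σ * X j := by
    intro j
    rw [hτdef, Finset.sum_mul, Finset.sum_eq_single j]
    · rw [Matrix.mul_assoc, hX.mul_self]
    · intro k _ hk
      rw [Matrix.mul_assoc, hX.orthogonal k j hk, Matrix.mul_zero]
    · simp
  obtain ⟨g, J, μ, hμ, hJ, hg⟩ := hX.exists_adapted_basis hτ fun j => (hXτ j).trans (hτX j).symm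
  -- extend the register states to a basis of the register
  have hcard : Fintype.card ι ≤ Fintype.card m := by
    simpa using hw.linearIndependent.fintype_card_le_finrank
  obtain ⟨r⟩ := Function.Embedding.nonempty_of_card_le hcard
  obtain ⟨f, hf⟩ : ∃ f : OrthonormalBasis m ℂ (EuclideanSpace ℂ m), ∀ j, f (r j) = w j := by
    let v : m → EuclideanSpace ℂ m := Function.extend r w 0
    have hv : ∀ j, v (r j) = w j := fun j => r.injective.extend_apply w 0 j
    have ho : Orthonormal ℂ ((Set.range r).domRestrict v) := by
      let eq := Equiv.ofInjective r r.injective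
      have h1 : ((Set.range r).domRestrict v) = w ∘ eq.symm := by
        ext1 x
        obtain ⟨j, rfl⟩ := eq.surjective x
        simp [eq, hv, Set.domRestrict_apply]
      rw [h1]
      exact hw.comp _ eq.symm.injective
    obtain ⟨f, hf⟩ := ho.exists_orthonormalBasis_extension_of_card_eq (by simp)
    exact ⟨f, fun j => (hf _ ⟨j, rfl⟩).trans (hv j)⟩
  have hτg : ∀ k, τ * ketbra (g k) = (μ k : ℂ) • ketbra (g k) := fun k => by
    rw [mul_ketbra, hg, smul_vecMulVec]; rfl
  have hXg : ∀ j k, X j * ketbra (g k) = if j = J k then ketbra (g k) else 0 := fun j k => by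
    rw [mul_ketbra, ← hJ k, mulVec_mulVec, hX.mul_eq]
    split_ifs with h
    · rw [hJ k]; rfl
    · rw [zero_mulVec, zero_vecMulVec]
  have hτsum : τ = ∑ k, (μ k : ℂ) • ketbra (g k) := by
    calc τ = τ * ∑ k, ketbra (g k) := by rw [sum_ketbra, Matrix.mul_one]
      _ = ∑ k, (μ k : ℂ) • ketbra (g k) := by simp only [Finset.mul_sum, hτg]
  refine ⟨f, g, fun x k => if x = r (J k) then μ k else 0, fun x k => ?_, ?_, ?_⟩
  · dsimp only
    split_ifs
    exacts [hμ k, le_rfl]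
  · rw [Finset.sum_comm]
    simp only [Finset.sum_ite_eq', Finset.mem_univ, if_true]
    have h1 := hτ.2
    rw [hτsum, trace_sum] at h1
    simp only [trace_smul, (isDensity_ketbra g _).2, smul_eq_mul, mul_one] at h1
    exact_mod_cast h1
  · rw [hτdef, premeasState_pinch hX]
    have h1 : ∀ j, X j * σ * X j = ∑ k, if j = J k then (μ k : ℂ) • ketbra (g k) else 0 := by
      intro j
      rw [← hXτ, hτsum, Finset.mul_sum]
      refine Finset.sum_congr rfl fun k _ => ?_
      rw [Matrix.mul_smul, hXg]
      split_ifs <;> simp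
    have h2 : ∀ j, ketbra (w j) ⊗ₖ (X j * σ * X j) =
        ∑ k, if j = J k then (μ k : ℂ) • (ketbra (w j) ⊗ₖ ketbra (g k)) else 0 := by
      intro j
      rw [h1]
      ext x y
      simp only [kroneckerMap_apply, Matrix.sum_apply, Finset.mul_sum]
      refine Finset.sum_congr rfl fun k _ => ?_
      split_ifs
      · simp only [Matrix.smul_apply, kroneckerMap_apply, smul_eq_mul]; ring
      · simp
    simp only [h2]
    rw [Finset.sum_comm, Finset.sum_comm (s := (Finset.univ : Finset m))]
    refine Finset.sum_congr rfl fun k _ => ?_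
    rw [Finset.sum_eq_single (J k) (fun j _ hj => if_neg hj) (by simp),
      Finset.sum_eq_single (r (J k)) (fun x _ hx => by simp [hx]) (by simp)]
    simp [hf]

theorem posSemidef_premeasState {ρ : Matrix s s ℂ} (hρ : ρ.PosSemidef) :
    (premeasState w X ρ).PosSemidef :=
  hρ.mul_mul_conjTranspose_same _

theorem traceRight_ketbra_premeasVector {ρ : Matrix s s ℂ} {ψ : EuclideanSpace ℂ (s × e)}
    (h : IsPurification ψ ρ) :
    traceRight (ketbra (premeasVector w X ψ)) = premeasState w X ρ := by
  unfold IsPurification at h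
  rw [traceRight_ketbra] at h ⊢
  have h1 : ampRight (premeasVector w X ψ) = premeasIsometry w X * ampRight ψ := by
    ext x z
    simp only [ampRight, premeasVector, of_apply, mulVec, dotProduct, Matrix.mul_apply,
      Fintype.sum_prod_type, kroneckerMap_apply, one_apply]
    exact Finset.sum_congr rfl fun t _ => by simp
  rw [h1, conjTranspose_mul, premeasState, ← h]
  simp only [Matrix.mul_assoc]

theorem isDensity_premeasState (hw : Orthonormal ℂ w) (hX : IsPVM X) {ρ : Matrix s s ℂ}
    (hρ : IsDensity ρ) : IsDensity (premeasState w X ρ) :=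
  ⟨posSemidef_premeasState hρ.1, by
    rw [premeasState, trace_mul_comm, ← Matrix.mul_assoc, premeasIsometry_isometry hw hX,
      Matrix.one_mul, hρ.2]⟩

/-- On premeasurement states the measures of correlation all collapse to `-H(M_X|S)`. -/
theorem collapse {D : RelEnt.{u}} (hD : ChannelMonotone D) (hN : NullSubspaceInvariant D)
    (hw : Orthonormal ℂ w) (hX : IsPVM X) {ρ : Matrix s s ℂ} (hρ : IsDensity ρ) :
    -condEntropy D m s (premeasState w X ρ) = entanglement D (premeasState w X ρ) ∧
      entanglement D (premeasState w X ρ) = discordLeft D (premeasState w X ρ) ∧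
      discordLeft D (premeasState w X ρ) = discordRight D (premeasState w X ρ) ∧
      discordRight D (premeasState w X ρ) = discordTwoWay D (premeasState w X ρ) := by
  have h1 : -condEntropy D m s (premeasState w X ρ) ≤ entanglement D (premeasState w X ρ) := by
    rw [neg_condEntropy_eq_iInf]
    refine le_iInf₂ fun ω hω => ?_
    obtain ⟨hpos, σ, hσ, hle⟩ := exists_isDensity_posSemidef_one_kronecker_sub hω
    exact iInf₂_le_of_le σ hσ (hD.anti_right hN (posSemidef_premeasState hρ.1) hpos hle)
  have h2 : discordTwoWay D (premeasState w X ρ) ≤ -condEntropy D m s (premeasState w X ρ) := by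
    rw [neg_condEntropy_eq_iInf]
    refine le_iInf₂ fun σ hσ => iInf₂_le_of_le _ (premeasState_pinch_mem_CC hw hX hσ) ?_
    have hV := premeasIsometry_isometry hw hX
    refine (hD.isometry_le hρ.1 (isDensity_pinch hX hσ).1 hV).trans ?_
    rw [← premeasIsometry_compress hw hX]
    exact hD.compress_le hN hρ.1 (PosSemidef.one.kronecker hσ.1) hV
  have h3 : entanglement D (premeasState w X ρ) ≤ discordLeft D (premeasState w X ρ) :=
    biInf_mono CQ_subset_Sep
  have h4 : entanglement D (premeasState w X ρ) ≤ discordRight D (premeasState w X ρ) :=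
    biInf_mono QC_subset_Sep
  have h5 : discordLeft D (premeasState w X ρ) ≤ discordTwoWay D (premeasState w X ρ) :=
    biInf_mono CC_subset_CQ
  have h6 : discordRight D (premeasState w X ρ) ≤ discordTwoWay D (premeasState w X ρ) :=
    biInf_mono CC_subset_QC
  have h7 := h2.trans h1
  exact ⟨le_antisymm h1 (h3.trans (h5.trans h2)), le_antisymm h3 (h5.trans h7),
    le_antisymm (h5.trans (h7.trans h4)) (h6.trans (h7.trans h3)),
    le_antisymm h6 (h7.trans h4)⟩

theorem uncertainty_dualEntropy {D : RelEnt.{u}} (hD : ChannelMonotone D)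
    (hw : Orthonormal ℂ w) (hX : IsPVM X) {ρ : Matrix s s ℂ} (hρ : IsDensity ρ)
    {ψ : EuclideanSpace ℂ (s × e)} (hψ : IsPurification ψ ρ) :
    uncertainty (dualEntropy D) w X ψ = -condEntropy D m s (premeasState w X ρ) := by
  have h := traceRight_ketbra_premeasVector (w := w) (X := X) hψ
  have hd : IsDensity (traceMiddle (ketbra (premeasVector w X ψ))) :=
    isDensity_traceMiddle_ketbra (h ▸ isDensity_premeasState hw hX hρ)
  rw [uncertainty, dualEntropy_eq hD hd (traceRight_ketbra_swapVector _),
    traceMiddle_ketbra_swapVector, h]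

end Premeasurement

/-! ### Tripartite pure states -/

section Tensors

variable {a b c k m n : Type*} [Fintype a] [DecidableEq a] [Fintype b] [DecidableEq b]
  [Fintype c] [DecidableEq c] [Fintype k] [DecidableEq k] [Fintype m] [DecidableEq m]
  [Fintype n] [DecidableEq n]

/-- Douglas' factorization lemma, with an inequality: the defect is absorbed by enlarging `M`. -/
theorem exists_isContraction_of_posSemidef_sub {G : Matrix n k ℂ} {M : Matrix n m ℂ}
    (h : (G * Gᴴ - M * Mᴴ).PosSemidef) : ∃ V : Matrix k m ℂ, IsContraction V ∧ M = G * V := by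
  obtain ⟨V, hV, e⟩ := exists_isContraction_of_mul_conjTranspose_eq
    (M := G) (N := fromCols M (CFC.sqrt (G * Gᴴ - M * Mᴴ))) (by
      rw [conjTranspose_fromCols_eq_fromRows_conjTranspose, fromCols_mul_fromRows,
        conjTranspose_sqrt, h.sqrt_mul_sqrt]
      abel)
  have h1 : IsContraction (fromRows 1 0 : Matrix (m ⊕ n) m ℂ) := by
    unfold IsContraction
    rw [conjTranspose_fromRows_eq_fromCols_conjTranspose, fromCols_mul_fromRows]
    simp [PosSemidef.zero]
  refine ⟨V * fromRows 1 0, hV.mul h1, ?_⟩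
  rw [← Matrix.mul_assoc, ← e, fromCols_mul_fromRows]
  simp

theorem IsContraction.re_trace_le {W : Matrix n m ℂ} (hW : IsContraction W) (A : Matrix m k ℂ) :
    (W * A * (W * A)ᴴ).trace.re ≤ (A * Aᴴ).trace.re := by
  have h := (PosSemidef.conjTranspose_mul_mul_same hW A).trace_nonneg
  have e : (Aᴴ * (1 - Wᴴ * W) * A).trace = (A * Aᴴ).trace - (W * A * (W * A)ᴴ).trace := by
    rw [trace_mul_comm A, trace_mul_comm (W * A), ← trace_sub, conjTranspose_mul, Matrix.mul_sub,
      Matrix.sub_mul, Matrix.mul_one]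
    simp only [Matrix.mul_assoc]
  rw [e] at h
  have h' := (Complex.le_def.mp h).1
  simpa using h'

theorem sq_re_trace_le {A B : Matrix n m ℂ} {l : ℝ} (hA : (A * Aᴴ).trace.re ≤ 1)
    (hB : (B * Bᴴ).trace.re ≤ l) : (A * Bᴴ).trace.re ^ 2 ≤ l := by
  set t := (A * Bᴴ).trace.re with ht
  have h := (Complex.le_def.mp
    (posSemidef_self_mul_conjTranspose ((t : ℂ) • A - B)).trace_nonneg).1
  have e3 : (B * Aᴴ).trace = star (A * Bᴴ).trace := by
    rw [← trace_conjTranspose, conjTranspose_mul, conjTranspose_conjTranspose]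
  have e : (((t : ℂ) • A - B) * ((t : ℂ) • A - B)ᴴ).trace.re =
      t * (t * (A * Aᴴ).trace.re) - t * t - t * t + (B * Bᴴ).trace.re := by
    simp only [conjTranspose_sub, conjTranspose_smul, Matrix.sub_mul, Matrix.mul_sub,
      Matrix.smul_mul, Matrix.mul_smul, trace_sub, trace_smul, smul_eq_mul, e3, Complex.sub_re]
    simp [← ht]
    ring
  rw [e, Complex.zero_re] at h
  nlinarith [mul_nonneg (mul_self_nonneg t) (sub_nonneg.mpr hA)]

/-- The exchange of the second row index of a tensor with its column index. -/
def exchange (W : Matrix (a × c) b ℂ) : Matrix (a × b) c ℂ :=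
  Matrix.of fun x z => W (x.1, z) x.2

theorem exchange_exchange (W : Matrix (a × c) b ℂ) : exchange (exchange W) = W := rfl

theorem ampMiddle_eq_exchange (φ : EuclideanSpace ℂ ((a × b) × c)) :
    ampMiddle φ = exchange (ampRight φ) := rfl

theorem trace_exchange (A B : Matrix (a × c) b ℂ) :
    (exchange A * (exchange B)ᴴ).trace = (A * Bᴴ).trace := by
  simp only [trace, diag_apply, Matrix.mul_apply, conjTranspose_apply, exchange, of_apply,
    Fintype.sum_prod_type]
  exact Finset.sum_congr rfl fun i _ => Finset.sum_comm

theorem exchange_one_kronecker_mul {d : Type*} [Fintype d] [DecidableEq d] (S : Matrix d c ℂ)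
    (W : Matrix (a × c) b ℂ) : exchange (((1 : Matrix a a ℂ) ⊗ₖ S) * W) = exchange W * Sᵀ := by
  ext ⟨i, y⟩ z
  simp only [exchange, of_apply, Matrix.mul_apply, Fintype.sum_prod_type, kroneckerMap_apply,
    one_apply, transpose_apply]
  rw [Finset.sum_eq_single i]
  · simp [mul_comm]
  · intro x _ hx
    simp [hx.symm]
  · simp

theorem sqrt_one_kronecker {σ : Matrix c c ℂ} (hσ : σ.PosSemidef) :
    CFC.sqrt ((1 : Matrix a a ℂ) ⊗ₖ σ) = (1 : Matrix a a ℂ) ⊗ₖ CFC.sqrt σ := by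
  refine CFC.sqrt_unique ?_
    (Matrix.nonneg_iff_posSemidef.mpr (PosSemidef.one.kronecker (posSemidef_sqrt σ)))
  rw [← mul_kronecker_mul, Matrix.one_mul, hσ.sqrt_mul_sqrt]

/-- Weak duality between `D_max` on `AB` and the fidelity on `AC`: the bound `1 ⊗ Y` factors `φ` as
`√Y` times a contraction, Uhlmann's theorem factors its partner as `√σ` times a contraction, and the
Cauchy-Schwarz inequality bounds the overlap by `√(Tr Y Tr σ)`. -/
theorem sq_fidelity_le {φ : EuclideanSpace ℂ ((a × b) × c)} {Y : Matrix b b ℂ} {σ : Matrix c c ℂ}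
    (hY : Y.PosSemidef) (h : ((1 : Matrix a a ℂ) ⊗ₖ Y - traceRight (ketbra φ)).PosSemidef)
    (hσ : IsDensity σ) :
    fidelity (traceMiddle (ketbra φ)) ((1 : Matrix a a ℂ) ⊗ₖ σ) ^ 2 ≤ Y.trace.re := by
  rw [traceMiddle_ketbra]
  obtain ⟨W, hW, hF⟩ := exists_isContraction_trace_mul_eq_fidelity (ampMiddle φ)
    (PosSemidef.one.kronecker hσ.1 : ((1 : Matrix a a ℂ) ⊗ₖ σ).PosSemidef)
  rw [sqrt_one_kronecker hσ.1] at hF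
  set S := CFC.sqrt σ
  have hS : Sᴴ = S := conjTranspose_sqrt σ
  set R := CFC.sqrt Y
  have hR : Rᴴ = R := conjTranspose_sqrt Y
  set G := (1 : Matrix a a ℂ) ⊗ₖ R
  have hG : Gᴴ = G := by rw [conjTranspose_kronecker, conjTranspose_one, hR]
  have hGG : G * Gᴴ = (1 : Matrix a a ℂ) ⊗ₖ Y := by
    rw [hG, ← mul_kronecker_mul, Matrix.one_mul, hY.sqrt_mul_sqrt]
  obtain ⟨V, hV, hM⟩ := exists_isContraction_of_posSemidef_sub (G := G) (M := ampRight φ)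
    (by rwa [hGG, ← traceRight_ketbra])
  have e : (ampMiddle φ * Wᴴ * ((1 : Matrix a a ℂ) ⊗ₖ S)).trace =
      (V * Sᵀᴴ * (exchange (W * Rᵀ))ᴴ).trace := by
    have h1 : exchange (W * Rᵀ) = G * exchange W := by
      have := exchange_one_kronecker_mul R (exchange W)
      rw [exchange_exchange] at this
      rw [← this, exchange_exchange]
    calc (ampMiddle φ * Wᴴ * ((1 : Matrix a a ℂ) ⊗ₖ S)).trace
        = (exchange (ampRight φ) * (((1 : Matrix a a ℂ) ⊗ₖ S) * W)ᴴ).trace := by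
          rw [conjTranspose_mul, conjTranspose_kronecker, hS, conjTranspose_one, Matrix.mul_assoc,
            ampMiddle_eq_exchange]
      _ = (ampRight φ * (exchange W * Sᵀ)ᴴ).trace := by
          rw [← trace_exchange, exchange_exchange, exchange_one_kronecker_mul]
      _ = (V * Sᵀᴴ * (exchange (W * Rᵀ))ᴴ).trace := by
          rw [h1, hM, conjTranspose_mul, conjTranspose_mul, hG, Matrix.mul_assoc, trace_mul_comm]
          simp only [Matrix.mul_assoc]
  rw [← hF, e]
  refine sq_re_trace_le ((hV.re_trace_le _).trans ?_) ?_
  · have h1 : Sᵀᴴ * Sᵀᴴᴴ = σᵀ := by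
      have hST : Sᵀᴴ = Sᵀ := congrArg Matrix.transpose hS
      rw [hST, hST, ← transpose_mul, hσ.1.sqrt_mul_sqrt]
    rw [h1, trace_transpose, hσ.2, Complex.one_re]
  · rw [trace_exchange]
    refine (hW.re_trace_le _).trans ?_
    have h1 : Rᵀ * Rᵀᴴ = Yᵀ := by
      have hRT : Rᵀᴴ = Rᵀ := congrArg Matrix.transpose hR
      rw [hRT, ← transpose_mul, hY.sqrt_mul_sqrt]
    rw [h1, trace_transpose]

/-- The partial trace over the first of two systems. -/
def traceLeft (Z : Matrix (a × b) (a × b) ℂ) : Matrix b b ℂ :=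
  Matrix.of fun y y' => ∑ i, Z (i, y) (i, y')

theorem trace_mul_one_kronecker (Z : Matrix (a × b) (a × b) ℂ) (τ : Matrix b b ℂ) :
    (Z * ((1 : Matrix a a ℂ) ⊗ₖ τ)).trace = (traceLeft Z * τ).trace := by
  simp only [trace, diag_apply, Matrix.mul_apply, traceLeft, of_apply, Fintype.sum_prod_type,
    kroneckerMap_apply, one_apply, Finset.sum_mul]
  rw [Finset.sum_comm]
  refine Finset.sum_congr rfl fun y _ => ?_
  refine Eq.trans (Finset.sum_congr rfl fun i _ => ?_) Finset.sum_comm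
  rw [Finset.sum_eq_single i]
  · simp
  · intro x _ hx
    simp [hx]
  · simp

/-- A feasible point `Z` of the dual program of `D_max` on `AB` yields a state on `C` of large
fidelity. -/
theorem exists_isDensity_le_sq_fidelity {φ : EuclideanSpace ℂ ((a × b) × c)}
    {Z : Matrix (a × b) (a × b) ℂ} (hZ : Z.PosSemidef) (hZ1 : (1 - traceLeft Z).PosSemidef)
    (hpos : 0 < (Z * traceRight (ketbra φ)).trace.re) :
    ∃ σ : Matrix c c ℂ, IsDensity σ ∧ (Z * traceRight (ketbra φ)).trace.re ≤
      fidelity (traceMiddle (ketbra φ)) ((1 : Matrix a a ℂ) ⊗ₖ σ) ^ 2 := by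
  rw [traceRight_ketbra] at hpos ⊢
  rw [traceMiddle_ketbra]
  set M := ampRight φ with hM
  set v := (Z * (M * Mᴴ)).trace.re with hv
  set R := CFC.sqrt Z
  have hR : Rᴴ = R := conjTranspose_sqrt Z
  have hRR : R * R = Z := hZ.sqrt_mul_sqrt
  let K : Matrix c (a × b) ℂ := (R * M)ᵀ
  have hK : (K * Kᴴ).trace = (Z * (M * Mᴴ)).trace := by
    have : K * Kᴴ = ((R * M)ᴴ * (R * M))ᵀ := by
      rw [transpose_mul]; rfl
    rw [this, trace_transpose, conjTranspose_mul, hR, Matrix.mul_assoc, ← Matrix.mul_assoc R, hRR,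
      trace_mul_comm, Matrix.mul_assoc]
  have hKpos := posSemidef_self_mul_conjTranspose K
  have hvc : (K * Kᴴ).trace = (v : ℂ) := by
    have h0 := (Complex.le_def.mp hKpos.trace_nonneg).2
    refine Complex.ext ?_ ?_
    · rw [hK, Complex.ofReal_re]
    · rw [Complex.ofReal_im, ← h0, Complex.zero_im]
  have hv0 : (v : ℂ) ≠ 0 := Complex.ofReal_ne_zero.mpr hpos.ne'
  have hr : IsContraction (exchange R) := by
    have h1 : (exchange R)ᴴ * exchange R = (traceLeft Z)ᵀ := by
      ext y y'
      simp only [Matrix.mul_apply, conjTranspose_apply, exchange, of_apply, Fintype.sum_prod_type,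
        transpose_apply, traceLeft]
      refine Finset.sum_congr rfl fun i _ => ?_
      rw [← hRR]
      conv_rhs => rw [← congrArg (fun T => (R * T) (i, y') (i, y)) hR]
      simp only [Matrix.mul_apply, conjTranspose_apply, Fintype.sum_prod_type]
      exact Finset.sum_congr rfl fun _ _ => Finset.sum_congr rfl fun _ _ => mul_comm _ _
    have h2 := hZ1.transpose
    unfold IsContraction
    rwa [h1, ← transpose_one, ← transpose_sub]
  refine ⟨((v⁻¹ : ℝ) : ℂ) • (K * Kᴴ),
    ⟨hKpos.smul (Complex.zero_le_real.mpr (inv_nonneg.mpr hpos.le)), ?_⟩, ?_⟩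
  · rw [trace_smul, hvc, smul_eq_mul, Complex.ofReal_inv, inv_mul_cancel₀ hv0]
  set x : ℝ := (√v)⁻¹ with hx
  have hxx : x * x = v⁻¹ := by rw [hx, ← mul_inv, Real.mul_self_sqrt hpos.le]
  -- the vector `Z φ / √v`, as a matrix from `b` to `a × c`
  set N : Matrix (a × c) b ℂ := (x : ℂ) • (((1 : Matrix a a ℂ) ⊗ₖ K) * exchange R) with hN
  have hle : ((1 : Matrix a a ℂ) ⊗ₖ (((v⁻¹ : ℝ) : ℂ) • (K * Kᴴ)) - N * Nᴴ).PosSemidef := by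
    have h1 := (PosSemidef.mul_mul_conjTranspose_same
      (isContraction_iff_posSemidef_one_sub_mul_conjTranspose.mp hr)
      ((1 : Matrix a a ℂ) ⊗ₖ K)).smul
      (Complex.zero_le_real.mpr (inv_nonneg.mpr hpos.le))
    have e : (1 : Matrix a a ℂ) ⊗ₖ (((v⁻¹ : ℝ) : ℂ) • (K * Kᴴ)) - N * Nᴴ =
        ((v⁻¹ : ℝ) : ℂ) • (((1 : Matrix a a ℂ) ⊗ₖ K) * (1 - exchange R * (exchange R)ᴴ) *
          ((1 : Matrix a a ℂ) ⊗ₖ K)ᴴ) := by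
      have e1 : ((1 : Matrix a a ℂ) ⊗ₖ K) * ((1 : Matrix a a ℂ) ⊗ₖ K)ᴴ =
          (1 : Matrix a a ℂ) ⊗ₖ (K * Kᴴ) := by
        rw [conjTranspose_kronecker, ← mul_kronecker_mul, conjTranspose_one, Matrix.one_mul]
      rw [hN, conjTranspose_smul, Matrix.smul_mul, Matrix.mul_smul, smul_smul, kronecker_smul,
        ← hxx, Matrix.mul_sub, Matrix.sub_mul, Matrix.mul_one, e1, smul_sub, conjTranspose_mul]
      simp only [Matrix.mul_assoc, Complex.ofReal_mul, RCLike.star_def, Complex.conj_ofReal]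
    rwa [e]
  have hF := re_trace_mul_conjTranspose_le_fidelity (ampMiddle φ) N hle
  have ht : (ampMiddle φ * Nᴴ).trace.re = x * v := by
    have h1 : ((1 : Matrix a a ℂ) ⊗ₖ K) * exchange R = exchange (Z * M) := by
      have := exchange_one_kronecker_mul K (exchange R)
      rw [exchange_exchange, transpose_transpose, ← Matrix.mul_assoc, hRR] at this
      rw [← this, exchange_exchange]
    rw [hN, h1, ampMiddle_eq_exchange, conjTranspose_smul, Matrix.mul_smul, trace_smul,
      trace_exchange, conjTranspose_mul, hZ.isHermitian.eq, ← hM, ← Matrix.mul_assoc,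
      trace_mul_comm]
    simp [hv]
  rw [ht] at hF
  have hxv : x * v = √v := by
    rw [hx, inv_mul_eq_div, Real.div_sqrt]
  rw [hxv] at hF
  calc v = √v ^ 2 := (Real.sq_sqrt hpos.le).symm
    _ ≤ _ := pow_le_pow_left₀ (Real.sqrt_nonneg v) hF 2

end Tensors

/-! ### Separation -/

section Separation

variable {a b n : Type*} [Fintype a] [DecidableEq a] [Fintype b] [DecidableEq b]
  [Fintype n] [DecidableEq n]

theorem isClosed_setOf_posSemidef : IsClosed {M : Matrix n n ℂ | M.PosSemidef} := by
  have h : {M : Matrix n n ℂ | M.PosSemidef} =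
      {M | Mᴴ = M} ∩ ⋂ x : n → ℂ, {M | 0 ≤ star x ⬝ᵥ (M *ᵥ x)} := by
    ext M
    simp only [Set.mem_ofPred_eq, posSemidef_iff_dotProduct_mulVec, Set.mem_inter_iff,
      Set.mem_iInter, IsHermitian]
  rw [h]
  exact (isClosed_eq (by fun_prop) continuous_id).inter
    (isClosed_iInter fun x => isClosed_le continuous_const (by fun_prop))

theorem isCompact_setOf_isDensity : IsCompact {ρ : Matrix n n ℂ | IsDensity ρ} := by
  have h1 : IsCompact {B : Matrix n n ℂ | (B * Bᴴ).trace = 1} := by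
    have hpi : IsCompact (Set.univ.pi fun _ : n => Set.univ.pi fun _ : n =>
        Metric.closedBall (0 : ℂ) 1) :=
      isCompact_univ_pi fun _ => isCompact_univ_pi fun _ => isCompact_closedBall _ _
    refine IsCompact.of_isClosed_subset hpi (isClosed_eq (by fun_prop) continuous_const) ?_
    intro B hB i _ j _
    have h2 : ∑ i, ∑ j, ‖B i j‖ ^ 2 = 1 := by
      have h3 := congrArg Complex.re (show (B * Bᴴ).trace = 1 from hB)
      simp only [trace, diag_apply, Matrix.mul_apply, conjTranspose_apply, RCLike.star_def,
        Complex.mul_conj, Complex.re_sum, Complex.ofReal_re, Complex.one_re,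
        Complex.normSq_eq_norm_sq] at h3
      exact h3
    have h4 : ‖B i j‖ ^ 2 ≤ 1 := by
      rw [← h2]
      refine le_trans ?_ (Finset.single_le_sum (f := fun i => ∑ j, ‖B i j‖ ^ 2)
        (fun i _ => Finset.sum_nonneg fun j _ => sq_nonneg _) (Finset.mem_univ i))
      exact Finset.single_le_sum (f := fun j => ‖B i j‖ ^ 2) (fun j _ => sq_nonneg _)
        (Finset.mem_univ j)
    rw [mem_closedBall_zero_iff]
    exact (sq_le_one_iff₀ (norm_nonneg _)).mp h4
  have h2 : {ρ : Matrix n n ℂ | IsDensity ρ} =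
      (fun B : Matrix n n ℂ => B * Bᴴ) '' {B | (B * Bᴴ).trace = 1} := by
    ext ρ
    constructor
    · rintro ⟨hρ, ht⟩
      have e : CFC.sqrt ρ * (CFC.sqrt ρ)ᴴ = ρ := by rw [conjTranspose_sqrt, hρ.sqrt_mul_sqrt]
      exact ⟨CFC.sqrt ρ, by rw [Set.mem_ofPred_eq, e, ht], e⟩
    · rintro ⟨B, hB, rfl⟩
      exact ⟨posSemidef_self_mul_conjTranspose B, hB⟩
  rw [h2]
  exact h1.image (by fun_prop)

/-- A complex linear functional on matrices agrees, in its real part and on Hermitian matrices,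
with the trace pairing with a Hermitian matrix. -/
theorem exists_isHermitian_re_trace_eq (f : Matrix n n ℂ →ₗ[ℂ] ℂ) :
    ∃ Z : Matrix n n ℂ, Z.IsHermitian ∧
      ∀ A : Matrix n n ℂ, A.IsHermitian → (f A).re = (Z * A).trace.re := by
  let Z₀ : Matrix n n ℂ := Matrix.of fun i j => f (Matrix.single j i 1)
  have h0 : ∀ A, f A = (Z₀ * A).trace := by
    intro A
    conv_lhs => rw [Matrix.matrix_eq_sum_single A]
    simp only [map_sum, trace, diag_apply, Matrix.mul_apply, Z₀, of_apply]
    rw [Finset.sum_comm]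
    refine Finset.sum_congr rfl fun j _ => Finset.sum_congr rfl fun i _ => ?_
    have : Matrix.single i j (A i j) = A i j • Matrix.single i j (1 : ℂ) := by simp
    rw [this, map_smul, smul_eq_mul, mul_comm]
  refine ⟨(2⁻¹ : ℂ) • (Z₀ + Z₀ᴴ), ?_, fun A hA => ?_⟩
  · rw [IsHermitian, conjTranspose_smul, conjTranspose_add, conjTranspose_conjTranspose, add_comm]
    simp
  · have h1 : (Z₀ᴴ * A).trace = star (Z₀ * A).trace := by
      rw [← trace_conjTranspose, conjTranspose_mul, hA.eq, trace_mul_comm]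
    rw [h0, Matrix.smul_mul, trace_smul, Matrix.add_mul, trace_add, h1, RCLike.star_def,
      Complex.add_conj, smul_eq_mul]
    simp

theorem convex_setOf_isDensity : Convex ℝ {ρ : Matrix n n ℂ | IsDensity ρ} := by
  intro ρ hρ σ hσ x y hx hy hxy
  refine ⟨(hρ.1.smul hx).add (hσ.1.smul hy), ?_⟩
  rw [trace_add, trace_smul, trace_smul, hρ.2, hσ.2]
  simp only [Complex.real_smul, mul_one]
  exact_mod_cast hxy

theorem re_trace_mul_ketbra (Z : Matrix n n ℂ) (x : n → ℂ) :
    (Z * ketbra (WithLp.toLp 2 x)).trace = star x ⬝ᵥ (Z *ᵥ x) := by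
  rw [ketbra_eq_vecMulVec, mul_vecMulVec, trace_vecMulVec, dotProduct_comm]

theorem isHermitian_traceLeft {Z : Matrix (a × b) (a × b) ℂ} (hZ : Z.IsHermitian) :
    (traceLeft Z).IsHermitian := by
  ext y y'
  simp only [conjTranspose_apply, traceLeft, of_apply, star_sum]
  exact Finset.sum_congr rfl fun i _ => hZ.apply _ _

/-- Strong duality for the semidefinite program of `D_max`: if `P` is not below `v (1 ⊗ τ)` for any
state `τ`, a hyperplane separates it from the closed convex set of all operators that are. -/
theorem exists_dual_feasible [Nonempty b] {P : Matrix (a × b) (a × b) ℂ} (hP : P.IsHermitian)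
    {v : ℝ} (hv : 0 < v)
    (h : ∀ τ : Matrix b b ℂ, IsDensity τ →
      ¬ ((v : ℂ) • ((1 : Matrix a a ℂ) ⊗ₖ τ) - P).PosSemidef) :
    ∃ Z : Matrix (a × b) (a × b) ℂ, Z.PosSemidef ∧ (1 - traceLeft Z).PosSemidef ∧
      v < (Z * P).trace.re := by
  have hlc : LocallyConvexSpace ℝ (Matrix (a × b) (a × b) ℂ) :=
    inferInstanceAs (LocallyConvexSpace ℝ ((a × b) → (a × b) → ℂ))
  let L : Matrix b b ℂ →ₗ[ℝ] Matrix (a × b) (a × b) ℂ :=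
    { toFun := fun τ => (v : ℂ) • ((1 : Matrix a a ℂ) ⊗ₖ τ)
      map_add' := fun x y => by rw [kronecker_add, smul_add]
      map_smul' := fun r x => by
        rw [kronecker_smul, smul_comm]; rfl }
  have hL : ∀ τ, L τ = (v : ℂ) • ((1 : Matrix a a ℂ) ⊗ₖ τ) := fun _ => rfl
  have hLc : Continuous L := by
    refine continuous_matrix fun i j => ?_
    simp only [hL, Matrix.smul_apply, kroneckerMap_apply]
    fun_prop
  set S : Set (Matrix (a × b) (a × b) ℂ) :=
    (L '' {τ | IsDensity τ}) + (-{R : Matrix (a × b) (a × b) ℂ | R.PosSemidef}) with hS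
  have hpsd : Convex ℝ {R : Matrix (a × b) (a × b) ℂ | R.PosSemidef} :=
    fun R hR T hT x y hx hy _ => (PosSemidef.smul hR hx).add (PosSemidef.smul hT hy)
  have hconv : Convex ℝ S := (convex_setOf_isDensity.linear_image L).add hpsd.neg
  have hclosed : IsClosed S := by
    rw [hS, add_comm]
    exact isClosed_setOf_posSemidef.neg.add_right_of_isCompact (isCompact_setOf_isDensity.image hLc)
  have hmem : P ∉ S := by
    rintro ⟨_, ⟨τ, hτ, rfl⟩, R, hR, e⟩
    refine h τ hτ ?_
    have : (v : ℂ) • ((1 : Matrix a a ℂ) ⊗ₖ τ) - P = -R := by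
      rw [← e]; simp [hL]
    rw [this]
    exact hR
  obtain ⟨f, u, hfS, hfP⟩ := RCLike.geometric_hahn_banach_closed_point (𝕜 := ℂ) hconv hclosed hmem
  obtain ⟨Z, hZ, hfZ⟩ := exists_isHermitian_re_trace_eq f.toLinearMap
  have hfP' : u < (Z * P).trace.re := by rw [← hfZ P hP]; exact hfP
  have hfS' : ∀ τ : Matrix b b ℂ, IsDensity τ → ∀ R : Matrix (a × b) (a × b) ℂ, R.PosSemidef →
      v * (traceLeft Z * τ).trace.re - (Z * R).trace.re < u := by
    intro τ hτ R hR
    have h1 : L τ - R ∈ S := by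
      rw [sub_eq_add_neg]
      exact Set.add_mem_add ⟨τ, hτ, rfl⟩ (by simpa using hR)
    have hherm : (L τ - R).IsHermitian :=
      ((PosSemidef.one.kronecker hτ.1).smul (Complex.zero_le_real.mpr hv.le)).isHermitian.sub
        hR.isHermitian
    have h2 := hfS _ h1
    have h3 := hfZ _ hherm
    rw [hL, Matrix.mul_sub, trace_sub, Matrix.mul_smul, trace_smul, trace_mul_one_kronecker,
      smul_eq_mul, Complex.sub_re, Complex.re_ofReal_mul] at h3
    rw [← h3]
    exact h2
  obtain ⟨i⟩ := ‹Nonempty b›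
  have hτ₀ := isDensity_ketbra (EuclideanSpace.basisFun b ℂ) i
  set τ₀ := ketbra (EuclideanSpace.basisFun b ℂ i)
  have hZpos : Z.PosSemidef := by
    refine .of_dotProduct_mulVec_nonneg hZ fun x => ?_
    rw [← re_trace_mul_ketbra]
    have hR := posSemidef_ketbra (WithLp.toLp 2 x)
    set R := ketbra (WithLp.toLp 2 x)
    have him : (Z * R).trace.im = 0 := by
      rw [← Complex.conj_eq_iff_im, ← RCLike.star_def, ← trace_conjTranspose, conjTranspose_mul,
        hZ.eq, hR.isHermitian.eq, trace_mul_comm]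
    refine Complex.le_def.mpr ⟨?_, him.symm⟩
    -- otherwise large multiples of `R` violate the separation
    by_contra hneg
    rw [Complex.zero_re, not_le] at hneg
    set q := (Z * R).trace.re
    set p := v * (traceLeft Z * τ₀).trace.re
    have hr : 0 ≤ (|u - p| + 1) / -q := div_nonneg (by positivity) (by linarith)
    have h1 := hfS' τ₀ hτ₀ ((((|u - p| + 1) / -q : ℝ) : ℂ) • R)
      (hR.smul (Complex.zero_le_real.mpr hr))
    rw [Matrix.mul_smul, trace_smul, smul_eq_mul, Complex.re_ofReal_mul] at h1
    have h2 : (|u - p| + 1) / -q * q = -(|u - p| + 1) := by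
      rw [div_mul_eq_mul_div, div_neg, mul_div_cancel_right₀ _ hneg.ne]
    have h3 := le_abs_self (u - p)
    change p - (|u - p| + 1) / -q * q < u at h1
    rw [h2] at h1
    linarith
  have hbd : ∀ τ : Matrix b b ℂ, IsDensity τ → v * (traceLeft Z * τ).trace.re < u := by
    intro τ hτ
    have := hfS' τ hτ 0 PosSemidef.zero
    simpa using this
  have hu : 0 < u := by
    refine lt_of_le_of_lt ?_ (hbd τ₀ hτ₀)
    refine mul_nonneg hv.le ?_
    rw [← trace_mul_one_kronecker]
    have h1 := (PosSemidef.one.kronecker hτ₀.1 : ((1 : Matrix a a ℂ) ⊗ₖ τ₀).PosSemidef)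
    have h2 := hZpos.mul_mul_conjTranspose_same (CFC.sqrt ((1 : Matrix a a ℂ) ⊗ₖ τ₀))
    rw [conjTranspose_sqrt] at h2
    have h3 := h2.trace_nonneg
    rw [Matrix.mul_assoc, trace_mul_comm, Matrix.mul_assoc, h1.sqrt_mul_sqrt] at h3
    exact (Complex.le_def.mp h3).1
  have hr : (0 : ℂ) ≤ ((v / u : ℝ) : ℂ) := Complex.zero_le_real.mpr (by positivity)
  refine ⟨((v / u : ℝ) : ℂ) • Z, hZpos.smul hr, ?_, ?_⟩
  · have hlin : traceLeft (((v / u : ℝ) : ℂ) • Z) = ((v / u : ℝ) : ℂ) • traceLeft Z := by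
      ext y y'
      simp [traceLeft, Finset.mul_sum]
    have hH := isHermitian_traceLeft (hZpos.smul hr).isHermitian
    refine .of_dotProduct_mulVec_nonneg (isHermitian_one.sub hH) fun x => ?_
    have hK := posSemidef_ketbra (WithLp.toLp 2 x)
    obtain ⟨τ, hτ, e⟩ := exists_isDensity_smul_eq hK hτ₀
    rw [hlin] at hH ⊢
    rw [← re_trace_mul_ketbra, Matrix.sub_mul, Matrix.one_mul, trace_sub]
    set k : ℝ := (ketbra (WithLp.toLp 2 x)).trace.re
    have hk : 0 ≤ k := (Complex.le_def.mp hK.trace_nonneg).1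
    have him : ((((v / u : ℝ) : ℂ) • traceLeft Z) * τ).trace.im = 0 := by
      rw [← Complex.conj_eq_iff_im, ← RCLike.star_def, ← trace_conjTranspose, conjTranspose_mul,
        hH.eq, hτ.1.isHermitian.eq, trace_mul_comm]
    rw [e, trace_smul, Matrix.mul_smul, trace_smul, hτ.2, ← smul_sub, smul_eq_mul]
    refine mul_nonneg (Complex.zero_le_real.mpr hk) (Complex.le_def.mpr ⟨?_, ?_⟩)
    · rw [Matrix.smul_mul, trace_smul, smul_eq_mul, Complex.sub_re, Complex.re_ofReal_mul,
        Complex.zero_re, Complex.one_re, div_mul_eq_mul_div, sub_nonneg]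
      exact (div_le_one hu).mpr (hbd τ hτ).le
    · rw [Complex.sub_im, him]
      simp
  · rw [Matrix.smul_mul, trace_smul, smul_eq_mul, Complex.re_ofReal_mul, div_mul_eq_mul_div,
      lt_div_iff₀ hu]
    exact mul_lt_mul_of_pos_left hfP' hv

end Separation

/-! ### Duality of the min- and max-entropies -/

section MinMax

variable {a b c : Type u} [Fintype a] [DecidableEq a] [Fintype b] [DecidableEq b]
  [Fintype c] [DecidableEq c] {β : ℝ}

/-- On a pure state of `ABC`, the min-entropy of `A` given `B` is the negative of the max-entropy of
`A` given `C`. -/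
theorem condEntropy_Dmax_eq_neg_condEntropy_Dfid (hβ : 1 < β)
    {φ : EuclideanSpace ℂ ((a × b) × c)} (hφ : IsDensity (traceRight (ketbra φ))) :
    condEntropy (Dmax β) a b (traceRight (ketbra φ)) =
      -condEntropy (Dfid β) a c (traceMiddle (ketbra φ)) := by
  have hD : condEntropy (Dfid β) a c (traceMiddle (ketbra φ)) =
      ⨆ (σ : Matrix c c ℂ) (_ : IsDensity σ), logBase β (ENNReal.ofReal
        (fidelity (traceMiddle (ketbra φ)) ((1 : Matrix a a ℂ) ⊗ₖ σ) ^ 2)) := by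
    simp only [condEntropy, neg_Dfid_eq_logBase_sq]
  rw [hD]
  refine le_antisymm (iSup₂_le fun τ hτ => ?_) ?_
  · rw [EReal.neg_le_neg_iff]
    refine iSup₂_le fun σ hσ => (logBase_strictMono hβ).monotone (le_iInf₂ fun l hl => ?_)
    rw [← kronecker_smul] at hl
    have h := sq_fidelity_le (hτ.1.smul (Complex.zero_le_real.mpr l.coe_nonneg)) hl hσ
    rw [trace_smul, hτ.2, smul_eq_mul, mul_one, Complex.ofReal_re] at h
    exact (ENNReal.ofReal_le_ofReal h).trans (by simp)
  · by_contra hlt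
    rw [not_le] at hlt
    obtain ⟨x, hx1, hx2⟩ := EReal.lt_iff_exists_real_btwn.mp hlt
    have hβ0 : 0 < β := by linarith
    set v : ℝ := β ^ (-x) with hv
    have hv0 : 0 < v := Real.rpow_pos_of_pos hβ0 _
    have hvx : logBase β (ENNReal.ofReal v) = -(x : EReal) := by
      rw [hv, logBase_ofReal_rpow hβ]; rfl
    by_cases hex : ∃ τ : Matrix b b ℂ, IsDensity τ ∧
        ((v : ℂ) • ((1 : Matrix a a ℂ) ⊗ₖ τ) - traceRight (ketbra φ)).PosSemidef
    · obtain ⟨τ, hτ, hpos⟩ := hex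
      refine hx1.not_ge (le_iSup₂_of_le τ hτ ?_)
      rw [EReal.le_neg, ← hvx]
      exact (logBase_strictMono hβ).monotone (iInf₂_le (⟨v, hv0.le⟩ : ℝ≥0) hpos |>.trans_eq
        (by rw [ENNReal.ofReal]; congr 1; exact (Real.toNNReal_of_nonneg hv0.le).symm))
    · push Not at hex
      obtain ⟨-, y⟩ := hφ.nonempty.some
      have : Nonempty b := ⟨y⟩
      obtain ⟨Z, hZ, hZ1, hlt'⟩ := exists_dual_feasible hφ.1.isHermitian hv0 hex
      obtain ⟨σ, hσ, hF⟩ := exists_isDensity_le_sq_fidelity hZ hZ1 (hv0.trans hlt')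
      refine hx2.not_ge ?_
      rw [EReal.neg_le, ← hvx]
      exact le_iSup₂_of_le σ hσ ((logBase_strictMono hβ).monotone
        (ENNReal.ofReal_le_ofReal (hlt'.le.trans hF)))

end MinMax

end PremeasurementCollapse

theorem mainTheorem6 :
    (∀ D : RelEnt.{u}, ChannelMonotone D → NullSubspaceInvariant D →
      (∀ (a b c : Type u) [Fintype a] [DecidableEq a] [Fintype b] [DecidableEq b]
          [Fintype c] [DecidableEq c] (ρ : Matrix (a × b) (a × b) ℂ)
          (φ : EuclideanSpace ℂ ((a × b) × c)), IsDensity ρ → IsPurification φ ρ →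
          dualEntropy D a b ρ = -condEntropy D a c (traceMiddle (ketbra φ))) ∧
      (∀ (ι : Type v) (m s e : Type u) [Fintype ι] [Fintype m] [DecidableEq m]
          [Fintype s] [DecidableEq s] [Fintype e] [DecidableEq e]
          (w : ι → EuclideanSpace ℂ m) (X : ι → Matrix s s ℂ) (ρ : Matrix s s ℂ)
          (ψ : EuclideanSpace ℂ (s × e)),
          Orthonormal ℂ w → IsPVM X → IsDensity ρ → IsPurification ψ ρ →
          uncertainty (dualEntropy D) w X ψ = entanglement D (premeasState w X ρ) ∧
          entanglement D (premeasState w X ρ) = discordLeft D (premeasState w X ρ) ∧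
          discordLeft D (premeasState w X ρ) = discordRight D (premeasState w X ρ) ∧
          discordRight D (premeasState w X ρ) = discordTwoWay D (premeasState w X ρ))) ∧
    (∀ (β : ℝ), 1 < β →
      ∀ (ι : Type v) (m s e : Type u) [Fintype ι] [Fintype m] [DecidableEq m]
        [Fintype s] [DecidableEq s] [Fintype e] [DecidableEq e]
        (w : ι → EuclideanSpace ℂ m) (X : ι → Matrix s s ℂ) (ρ : Matrix s s ℂ)
        (ψ : EuclideanSpace ℂ (s × e)),
        Orthonormal ℂ w → IsPVM X → IsDensity ρ → IsPurification ψ ρ →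
        (uncertainty (Hmin β) w X ψ = entanglement (Dfid β) (premeasState w X ρ) ∧
          entanglement (Dfid β) (premeasState w X ρ) =
            discordLeft (Dfid β) (premeasState w X ρ) ∧
          discordLeft (Dfid β) (premeasState w X ρ) =
            discordRight (Dfid β) (premeasState w X ρ) ∧
          discordRight (Dfid β) (premeasState w X ρ) =
            discordTwoWay (Dfid β) (premeasState w X ρ)) ∧
        (uncertainty (Hmax β) w X ψ = entanglement (Dmax β) (premeasState w X ρ) ∧
          entanglement (Dmax β) (premeasState w X ρ) =
            discordLeft (Dmax β) (premeasState w X ρ) ∧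
          discordLeft (Dmax β) (premeasState w X ρ) =
            discordRight (Dmax β) (premeasState w X ρ) ∧
          discordRight (Dmax β) (premeasState w X ρ) =
            discordTwoWay (Dmax β) (premeasState w X ρ))) := by
  refine ⟨fun D hD hN => ⟨?_, ?_⟩, ?_⟩
  · intro a b c _ _ _ _ _ _ ρ φ hρ hφ
    exact dualEntropy_eq hD hρ hφ
  · intro ι m s e _ _ _ _ _ _ _ w X ρ ψ hw hX hρ hψ
    rw [uncertainty_dualEntropy hD hw hX hρ hψ]
    exact collapse hD hN hw hX hρ
  · intro β hβ ι m s e _ _ _ _ _ _ _ w X ρ ψ hw hX hρ hψ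
    have hφ := traceRight_ketbra_premeasVector (w := w) (X := X) hψ
    have hd : IsDensity (traceRight (ketbra (premeasVector w X ψ))) :=
      hφ ▸ isDensity_premeasState hw hX hρ
    constructor
    · have h := condEntropy_Dmax_eq_neg_condEntropy_Dfid hβ
        (φ := swapVector (premeasVector w X ψ)) (by
          rw [traceRight_ketbra_swapVector]
          exact isDensity_traceMiddle_ketbra hd)
      rw [traceRight_ketbra_swapVector, traceMiddle_ketbra_swapVector, hφ] at h
      rw [uncertainty, Hmin, h]
      exact collapse (channelMonotone_Dfid hβ) (nullSubspaceInvariant_Dfid β) hw hX hρ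
    · have h := condEntropy_Dmax_eq_neg_condEntropy_Dfid hβ hd
      rw [hφ] at h
      rw [uncertainty, Hmax, ← neg_neg (condEntropy (Dfid β) m e _), ← h]
      exact collapse (channelMonotone_Dmax hβ) (nullSubspaceInvariant_Dmax β) hw hX hρ
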